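/- Let $\dot L^2(0,1)=\{\xi\in L^2(0,1;\mathbb C):\int_0^1\xi=0\}$ and consider on $\dot L^2(0,1)\times L^2(0,1)$ the unbounded operator $$A^*=\begin{pmatrix}\partial_x&\partial_x\\ \partial_x&\partial_{xx}+\partial_x\end{pmatrix},\qquad D(A^*)=\Big\{(\xi,\eta)\in H^1(0,1)\times H^2(0,1):\ \int_0^1\xi=0,\ \xi(0)=\xi(1),\ \eta(0)=\eta(1)=0\Big\}.$$ There exist integers $k_0,n_0\ge 1$ and complex numbers $\lambda^p_k$ ($k\in\mathbb N$, $k\ge k_0$), $\lambda^h_k$ ($k\in\mathbb Z$, $|k|\ge k_0$) and $\widehat\lambda_n$ ($1\le n\le n_0$) such that the spectrum of $A^*$ consists of eigenvalues and $$\sigma(A^*)=\{\lambda^p_k:\ k\ge k_0\}\cup\{\lambda^h_k:\ |k|\ge k_0\}\cup\{\widehat\lambda_n:\ 1\le n\le n_0\}.$$ Moreover, there are real sequences $(c_k)_{k\ge k_0}$, $(d_k)_{k\ge k_0}$, $(\alpha_{1,k})_{|k|\ge k_0}$, $(\alpha_{2,k})_{|k|\ge k_0}$, all bounded in absolute value by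 $\pi/2$, such that $$\lambda^p_k=-k^2\pi^2-2c_kk\pi-2id_kk\pi+O(1)\quad\text{as }k\to+\infty,$$ $$\lambda^h_k=-1-\alpha_{1,k}-i(2k\pi+\alpha_{2,k})\quad\text{for all }|k|\ge k_0,$$ with $c_k,d_k\to0$ as $k\to+\infty$, $\alpha_{1,k},\alpha_{2,k}\to0$ as $|k|\to\infty$, and, more precisely, $c_k=O(k^{-1})$, $d_k=O(k^{-1})$, $\alpha_{1,k}=O(|k|^{-1})$, $\alpha_{2,k}=O(|k|^{-1})$. -/

import Mathlib

open MeasureTheory Set Filter Topology Asymptotics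

noncomputable section

namespace NSSpectrum

/-- Lebesgue measure on the open interval `(0,1)`. -/
abbrev mu : Measure ℝ := volume.restrict (Ioo (0 : ℝ) 1)

/-- The complex Hilbert space `L²(0,1)`. -/
abbrev L2 : Type := Lp ℂ 2 mu

theorem integrable_L2 (f : L2) : Integrable f mu :=
  (Lp.memLp f).integrable (by norm_num)

theorem intervalIntegrable_L2 (f : L2) : IntervalIntegrable f volume 0 1 :=
  (intervalIntegrable_iff_integrableOn_Ioo_of_le zero_le_one).2 (integrable_L2 f)

theorem intervalIntegrable_L2' (f : L2) {x : ℝ} (hx : x ∈ Icc (0 : ℝ) 1) :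
    IntervalIntegrable f volume 0 x := by
  refine (intervalIntegrable_L2 f).mono_set ?_
  rw [uIcc_of_le hx.1, uIcc_of_le zero_le_one]
  exact Icc_subset_Icc_right hx.2

theorem intervalIntegral_congr_L2 {f g : ℝ → ℂ} (h : f =ᵐ[mu] g) {x : ℝ}
    (hx : x ∈ Icc (0 : ℝ) 1) : ∫ t in (0 : ℝ)..x, f t = ∫ t in (0 : ℝ)..x, g t := by
  rw [intervalIntegral.integral_of_le hx.1, intervalIntegral.integral_of_le hx.1,
    integral_Ioc_eq_integral_Ioo, integral_Ioc_eq_integral_Ioo]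
  exact integral_congr_ae
    (ae_restrict_of_ae_restrict_of_subset (Ioo_subset_Ioo_right hx.2) h)

/-- The space of mean-zero functions in `L²(0,1)`. -/
def meanZero : Submodule ℂ L2 where
  carrier := {f | ∫ x, f x ∂mu = 0}
  zero_mem' := by
    have h : ∫ x, (0 : L2) x ∂mu = ∫ _x, (0 : ℂ) ∂mu := integral_congr_ae (Lp.coeFn_zero ℂ 2 mu)
    simpa using h
  add_mem' := by
    intro f g hf hg
    have h : ∫ x, (f + g) x ∂mu = ∫ x, (f x + g x) ∂mu := integral_congr_ae (Lp.coeFn_add f g)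
    simp only [mem_ofPred_eq] at hf hg ⊢
    rw [h, integral_add (integrable_L2 f) (integrable_L2 g), hf, hg, add_zero]
  smul_mem' := by
    intro c f hf
    have h : ∫ x, (c • f) x ∂mu = ∫ x, c • f x ∂mu := integral_congr_ae (Lp.coeFn_smul c f)
    simp only [mem_ofPred_eq] at hf ⊢
    rw [h, integral_smul, hf, smul_zero]

/-- The state space of pairs `(ξ, η)` with `ξ, η ∈ L²(0,1)` and `∫ ξ = 0`.  (Its product norm is
equivalent to the Hilbert norm; only the topology matters below.) -/
abbrev State : Type := meanZero × L2

/-- `u ∈ H¹(0,1)` with derivative `u' ∈ L²(0,1)` and (absolutely) continuous representative `U`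
on `[0,1]`; the boundary values of `u` are `U 0` and `U 1`. -/
structure IsH1 (u u' : L2) (U : ℝ → ℂ) : Prop where
  ae_eq : u =ᵐ[mu] U
  eq_integral : ∀ x ∈ Icc (0 : ℝ) 1, U x = U 0 + ∫ t in (0 : ℝ)..x, u' t

theorem IsH1.zero : IsH1 0 0 0 where
  ae_eq := Lp.coeFn_zero ℂ 2 mu
  eq_integral := by
    intro x hx
    rw [intervalIntegral_congr_L2 (Lp.coeFn_zero ℂ 2 mu) hx]
    simp

theorem IsH1.add {u u' v v' : L2} {U V : ℝ → ℂ} (hu : IsH1 u u' U) (hv : IsH1 v v' V) :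
    IsH1 (u + v) (u' + v') (U + V) where
  ae_eq := (Lp.coeFn_add u v).trans (hu.ae_eq.add hv.ae_eq)
  eq_integral := by
    intro x hx
    have h := intervalIntegral.integral_add (intervalIntegrable_L2' u' hx)
      (intervalIntegrable_L2' v' hx)
    rw [intervalIntegral_congr_L2 (Lp.coeFn_add u' v') hx]
    simp only [Pi.add_apply]
    rw [h, hu.eq_integral x hx, hv.eq_integral x hx]
    ring

theorem IsH1.smul (c : ℂ) {u u' : L2} {U : ℝ → ℂ} (hu : IsH1 u u' U) :
    IsH1 (c • u) (c • u') (c • U) where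
  ae_eq := (Lp.coeFn_smul c u).trans (hu.ae_eq.const_smul c)
  eq_integral := by
    intro x hx
    rw [intervalIntegral_congr_L2 (Lp.coeFn_smul c u') hx]
    simp only [Pi.smul_apply]
    rw [intervalIntegral.integral_smul, hu.eq_integral x hx, smul_add]

/-- The derivative of the zero function is zero. -/
theorem IsH1.deriv_eq_zero {v : L2} {U : ℝ → ℂ} (h : IsH1 0 v U) : v = 0 := by
  have hc : ContinuousOn U (Ioo (0 : ℝ) 1) := by
    have h1 : ContinuousOn (fun x => U 0 + ∫ t in (0 : ℝ)..x, v t) (Icc (0 : ℝ) 1) := by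
      have := intervalIntegral.continuousOn_primitive_interval'
        (intervalIntegrable_L2 v) (left_mem_uIcc)
      rw [uIcc_of_le zero_le_one] at this
      exact continuousOn_const.add this
    exact (h1.congr h.eq_integral).mono Ioo_subset_Icc_self
  have hz : EqOn U (fun _ => 0) (Ioo (0 : ℝ) 1) := by
    refine Measure.eqOn_open_of_ae_eq (μ := volume) ?_ isOpen_Ioo hc continuousOn_const
    exact h.ae_eq.symm.trans (Lp.coeFn_zero ℂ 2 mu)
  rw [Lp.eq_zero_iff_ae_eq_zero]
  have hd := (intervalIntegrable_L2 v).ae_hasDerivAt_integral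
  refine (ae_restrict_iff' measurableSet_Ioo).2 ?_
  filter_upwards [hd] with x hx hxI
  have hx' := hx (by rw [uIcc_of_le zero_le_one]; exact Ioo_subset_Icc_self hxI) 0 (by simp)
  have he : (fun y => ∫ t in (0 : ℝ)..y, v t) =ᶠ[𝓝 x] fun _ => - U 0 := by
    filter_upwards [isOpen_Ioo.mem_nhds hxI] with y hy
    have h1 := h.eq_integral y (Ioo_subset_Icc_self hy)
    rw [hz hy] at h1
    exact (neg_eq_of_add_eq_zero_right h1.symm).symm
  exact (hx'.congr_of_eventuallyEq he.symm).unique (hasDerivAt_const x _)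

/-- The graph of the operator `(ξ, η) ↦ (ξ' + η', η'' + η' + ξ')` on
`{(ξ, η) : ξ ∈ H¹, η ∈ H², ∫ ξ = 0, ξ(0) = ξ(1), η(0) = η(1) = 0}`.
A member is a pair `((ξ, η), (f, g))`. -/
def adjointGraph : Submodule ℂ (State × State) where
  carrier := {p | ∃ (ξ' η' η'' : L2) (X Y Y' : ℝ → ℂ),
    IsH1 p.1.1 ξ' X ∧ IsH1 p.1.2 η' Y ∧ IsH1 η' η'' Y' ∧
    X 0 = X 1 ∧ Y 0 = 0 ∧ Y 1 = 0 ∧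
    (p.2.1 : L2) = ξ' + η' ∧ p.2.2 = η'' + η' + ξ'}
  zero_mem' := ⟨0, 0, 0, 0, 0, 0, IsH1.zero, IsH1.zero, IsH1.zero, rfl, rfl, rfl,
    by simp, by simp⟩
  add_mem' := by
    rintro p q ⟨a, b, c, A, B, C, h1, h2, h3, h4, h5, h6, h7, h8⟩
      ⟨a', b', c', A', B', C', k1, k2, k3, k4, k5, k6, k7, k8⟩
    refine ⟨a + a', b + b', c + c', A + A', B + B', C + C', h1.add k1, h2.add k2, h3.add k3,
      by simp [h4, k4], by simp [h5, k5], by simp [h6, k6], ?_, ?_⟩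
    · simp only [Prod.snd_add, Prod.fst_add, Submodule.coe_add, h7, k7]
      abel
    · simp only [Prod.snd_add, h8, k8]
      abel
  smul_mem' := by
    rintro z p ⟨a, b, c, A, B, C, h1, h2, h3, h4, h5, h6, h7, h8⟩
    refine ⟨z • a, z • b, z • c, z • A, z • B, z • C, h1.smul z, h2.smul z, h3.smul z,
      by simp [h4], by simp [h5], by simp [h6], ?_, ?_⟩
    · simp only [Prod.smul_snd, Prod.smul_fst, Submodule.coe_smul, h7, smul_add]
    · simp only [Prod.smul_snd, h8, smul_add]

theorem adjointGraph_univalent (p : State × State) (hp : p ∈ adjointGraph) (h0 : p.1 = 0) :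
    p.2 = 0 := by
  obtain ⟨a, b, c, A, B, C, h1, h2, h3, -, -, -, h7, h8⟩ := hp
  rw [h0] at h1 h2
  have ha : a = 0 := IsH1.deriv_eq_zero h1
  have hb : b = 0 := IsH1.deriv_eq_zero h2
  subst ha hb
  have hc : c = 0 := IsH1.deriv_eq_zero h3
  subst hc
  refine Prod.ext (Subtype.ext ?_) ?_
  · simpa using h7
  · simpa using h8

/-- The operator `A* = [[∂ₓ, ∂ₓ], [∂ₓ, ∂ₓₓ + ∂ₓ]]` with domain
`{(ξ, η) ∈ H¹ × H² : ∫ ξ = 0, ξ(0) = ξ(1), η(0) = η(1) = 0}`, as an unbounded operator on the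
state space. -/
def adjointOp : State →ₗ.[ℂ] State := adjointGraph.toLinearPMap

theorem adjointOp_graph : adjointOp.graph = adjointGraph :=
  Submodule.toLinearPMap_graph_eq _ adjointGraph_univalent

/-- The set of eigenvalues of an unbounded operator. -/
def eigenvalues {E : Type*} [AddCommGroup E] [Module ℂ E] (T : E →ₗ.[ℂ] E) : Set ℂ :=
  {z | ∃ Φ : T.domain, (Φ : E) ≠ 0 ∧ T Φ = z • (Φ : E)}

/-- The resolvent set of an unbounded operator `T`: those `z` for which `z - T`, defined on the
domain of `T`, has a bounded, everywhere defined, two-sided inverse `R`. -/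
def resolventSet {E : Type*} [NormedAddCommGroup E] [NormedSpace ℂ E] (T : E →ₗ.[ℂ] E) : Set ℂ :=
  {z | ∃ R : E →L[ℂ] E,
    (∀ F : E, ∃ h : R F ∈ T.domain, z • R F - T ⟨R F, h⟩ = F) ∧
    ∀ Φ : T.domain, R (z • (Φ : E) - T Φ) = Φ}

/-- The spectrum of an unbounded operator. -/
def spectrum {E : Type*} [NormedAddCommGroup E] [NormedSpace ℂ E] (T : E →ₗ.[ℂ] E) : Set ℂ :=
  (resolventSet T)ᶜ

end NSSpectrum

end

noncomputable section

namespace NSSpectrum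

/-! Solving the eigenvalue equation for the top derivatives gives a linear system `y' = sysOp z y`
for y = (ξ, η, η', ∫ξ) on [0,1]. The conditions at 0 leave two free initial data, and the
requirements η(1) = 0 and ∫ξ = 0 at 1 form a 2×2 linear system with determinant `charDet z`. The
condition ξ(0) = ξ(1) is then automatic. If `charDet z = 0`, a nontrivial solution is an
eigenfunction. Otherwise Duhamel's formula with suitable initial data gives a bounded inverse
(`mem_resolventSet_of_charDet_ne_zero`). Hence spectrum, eigenvalues and zero set of `charDet`
coincide. Since `charDet` is entire and not identically zero, each disc contains finitely many of
them.

For large z the exponents of the system are 0 and the roots of m³ - z m² - 2 z m + z² = 0. This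
curve is rational: z = (v - 1/v)(1 - 1/v) has the root m₁ = v - 1/v, and the other two roots are
close to -1/2 ± w with w² = v + O(1). In these terms `charDet z = 0` reads (exp m₁ - 1)(1 -
exp(-2w)) = O(max(1, |exp m₁|)/|v|), by `charDet_param_eq_zero_iff` and `norm_charRem_le`. A small
first factor puts v near 2πik (hyperbolic branch). A small second factor puts w near iπk up to sign,
so v near -π²k² (parabolic branch).

Near each of these points a logarithm turns the equation into a fixed point problem for a
holomorphic contraction, with exactly one solution and an explicit error (`exists_hyperbolic_zero`,
`exists_parabolic_zero`). Conversely, the bound on the product forces every large zero close to one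
of these points (`large_zero_cases`). The remaining zeros lie in a disc and are finite in number. -/

theorem adjointOp_apply_eq_iff (Φ F : State) :
    (∃ h : Φ ∈ adjointOp.domain, adjointOp ⟨Φ, h⟩ = F) ↔ (Φ, F) ∈ adjointGraph := by
  rw [← adjointOp_graph, LinearPMap.mem_graph_iff]
  constructor
  · rintro ⟨h, e⟩
    exact ⟨⟨Φ, h⟩, rfl, e⟩
  · rintro ⟨⟨y, hy⟩, rfl, e⟩
    exact ⟨hy, e⟩

theorem mem_eigenvalues_adjointOp_iff (z : ℂ) :
    z ∈ eigenvalues adjointOp ↔ ∃ Φ : State, Φ ≠ 0 ∧ (Φ, z • Φ) ∈ adjointGraph := by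
  constructor
  · rintro ⟨⟨Φ, hΦ⟩, h0, h⟩
    exact ⟨Φ, h0, (adjointOp_apply_eq_iff _ _).1 ⟨hΦ, h⟩⟩
  · rintro ⟨Φ, h0, h⟩
    obtain ⟨hΦ, e⟩ := (adjointOp_apply_eq_iff _ _).2 h
    exact ⟨⟨Φ, hΦ⟩, h0, e⟩

theorem eigenvalues_subset_spectrum {E : Type*} [NormedAddCommGroup E] [NormedSpace ℂ E]
    (T : E →ₗ.[ℂ] E) : eigenvalues T ⊆ spectrum T := by
  rintro z ⟨Φ, h0, h⟩ ⟨R, -, hR⟩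
  have := hR Φ
  rw [h, sub_self, map_zero] at this
  exact h0 this.symm

/-- Injectivity makes the solution of zΦ - A*Φ = F unique, so any choice of solutions is linear in
F, and the norm bound makes it continuous. -/
theorem mem_resolventSet_adjointOp (z : ℂ) (C : ℝ)
    (hinj : ∀ Φ : State, (Φ, z • Φ) ∈ adjointGraph → Φ = 0)
    (hsurj : ∀ F : State, ∃ Φ : State, (Φ, z • Φ - F) ∈ adjointGraph ∧ ‖Φ‖ ≤ C * ‖F‖) :
    z ∈ resolventSet adjointOp := by
  choose R hR hb using hsurj
  have huniq : ∀ (Φ F : State), (Φ, z • Φ - F) ∈ adjointGraph → Φ = R F := by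
    intro Φ F h
    have h1 := adjointGraph.sub_mem h (hR F)
    rw [← sub_eq_zero]
    apply hinj
    convert h1 using 1
    refine Prod.ext rfl ?_
    simp only [Prod.snd_sub, smul_sub]
    abel
  let L : State →ₗ[ℂ] State :=
    { toFun := R
      map_add' := by
        intro F G
        symm
        apply huniq
        convert adjointGraph.add_mem (hR F) (hR G) using 1
        refine Prod.ext rfl ?_
        simp only [Prod.snd_add, smul_add]
        abel
      map_smul' := by
        intro c F
        symm
        apply huniq
        convert adjointGraph.smul_mem c (hR F) using 1
        refine Prod.ext rfl ?_
        simp only [Prod.smul_snd, smul_sub, RingHom.id_apply, smul_comm z c] }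
  refine ⟨L.mkContinuous C hb, ?_, ?_⟩
  · intro F
    obtain ⟨h, e⟩ := (adjointOp_apply_eq_iff _ _).2 (hR F)
    refine ⟨h, ?_⟩
    change z • R F - adjointOp ⟨R F, h⟩ = F
    rw [e]
    abel
  · rintro ⟨Φ, hΦ⟩
    change R _ = Φ
    symm
    apply huniq
    refine (adjointOp_apply_eq_iff _ _).1 ⟨hΦ, ?_⟩
    simp

/-! ### Linear equations with constant coefficients: flow and Duhamel's formula -/

section LinearODE

theorem hasDerivWithinAt_complexCLM_apply {V : Type*} [NormedAddCommGroup V] [NormedSpace ℂ V]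
    {L : ℝ → V →L[ℂ] V} {L' : V →L[ℂ] V} {u : ℝ → V} {u' : V} {s : Set ℝ} {x : ℝ}
    (hL : HasDerivWithinAt L L' s x) (hu : HasDerivWithinAt u u' s x) :
    HasDerivWithinAt (fun t => L t (u t)) (L' (u x) + L x u') s x := by
  have h := (ContinuousLinearMap.restrictScalarsL ℂ V V ℝ ℝ).hasFDerivAt.comp_hasDerivWithinAt x hL
  exact h.clm_apply hu

theorem hasDerivAt_complexCLM_apply {V : Type*} [NormedAddCommGroup V] [NormedSpace ℂ V]
    {L : ℝ → V →L[ℂ] V} {L' : V →L[ℂ] V} {u : ℝ → V} {u' : V} {x : ℝ}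
    (hL : HasDerivAt L L' x) (hu : HasDerivAt u u' x) :
    HasDerivAt (fun t => L t (u t)) (L' (u x) + L x u') x := by
  rw [← hasDerivWithinAt_univ] at *
  exact hasDerivWithinAt_complexCLM_apply hL hu

variable {V : Type*} [NormedAddCommGroup V] [NormedSpace ℂ V]

/-- The flow `exp (x A)` of the linear equation `y' = A y`. -/
def flow (A : V →L[ℂ] V) (x : ℝ) : V →L[ℂ] V := NormedSpace.exp ((x : ℂ) • A)

theorem commute_flow (A : V →L[ℂ] V) (x : ℝ) : A * flow A x = flow A x * A :=
  (((Commute.refl A).smul_right _).exp_right).eq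

@[simp] theorem flow_zero (A : V →L[ℂ] V) : flow A 0 = 1 := by
  simp [flow]

variable [CompleteSpace V]

theorem hasDerivAt_flow (A : V →L[ℂ] V) (x : ℝ) :
    HasDerivAt (flow A) (A * flow A x) x := by
  have h := hasDerivAt_exp_smul_const' (𝕂 := ℂ) A (x : ℂ)
  exact (HasDerivAt.scomp (g₁ := fun u : ℂ => NormedSpace.exp (u • A)) x h
    Complex.ofRealCLM.hasDerivAt).congr_deriv (by simp [flow])

theorem continuous_flow (A : V →L[ℂ] V) : Continuous (flow A) :=
  continuous_iff_continuousAt.2 fun x => (hasDerivAt_flow A x).continuousAt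

theorem flow_mul_neg (A : V →L[ℂ] V) (x : ℝ) : flow A x * flow A (-x) = 1 := by
  have hc : Commute ((x : ℂ) • A) (((-x : ℝ) : ℂ) • A) :=
    ((Commute.refl A).smul_left _).smul_right _
  rw [flow, flow, ← NormedSpace.exp_add_of_commute_of_mem_ball (𝕂 := ℂ) hc]
  · rw [← add_smul]; simp
  · rw [NormedSpace.expSeries_radius_eq_top]; simp
  · rw [NormedSpace.expSeries_radius_eq_top]; simp

theorem hasDerivAt_flow_neg (A : V →L[ℂ] V) (x : ℝ) :
    HasDerivAt (fun x => flow A (-x)) (-(flow A (-x) * A)) x := by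
  have h := (hasDerivAt_flow A (-x)).scomp x (hasDerivAt_neg x)
  rw [commute_flow] at h
  simpa [Function.comp_def] using h

/-- An eigenvector moves along the flow by an exponential. -/
theorem flow_apply_eigenvector (A : V →L[ℂ] V) {m : ℂ} {v : V} (h : A v = m • v) (x : ℝ) :
    flow A x v = Complex.exp (m * x) • v := by
  have hd : ∀ t : ℝ, HasDerivAt (fun t : ℝ => flow A (-t) (Complex.exp (m * t) • v)) 0 t := by
    intro t
    have h1 : HasDerivAt (fun t : ℝ => Complex.exp (m * t)) (Complex.exp (m * t) * m) t := by
      have := ((hasDerivAt_id (t : ℂ)).const_mul m).cexp.comp_ofReal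
      simpa using this
    have h2 := hasDerivAt_complexCLM_apply (hasDerivAt_flow_neg A t) (h1.smul_const v)
    convert h2 using 1
    simp [h, smul_smul]
  have h3 := is_const_of_deriv_eq_zero (fun t => (hd t).differentiableAt)
    (fun t => (hd t).deriv) x 0
  simp only [Complex.ofReal_zero, neg_zero, flow_zero, mul_zero, Complex.exp_zero, one_smul,
    one_apply_eq_self] at h3
  have h4 := congrArg (flow A x) h3
  rw [← mul_apply_eq_comp, flow_mul_neg] at h4
  simpa using h4.symm

/-- The function `flow A (-x) (y x)` has zero right derivative, hence is constant. -/
theorem eq_flow_of_integral_eq (A : V →L[ℂ] V) {y : ℝ → V} (hy : ContinuousOn y (Icc 0 1))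
    (h : ∀ x ∈ Icc (0 : ℝ) 1, y x = y 0 + ∫ t in (0 : ℝ)..x, A (y t)) :
    ∀ x ∈ Icc (0 : ℝ) 1, y x = flow A x (y 0) := by
  have hc : ContinuousOn (fun x => flow A (-x) (y x)) (Icc 0 1) :=
    ((continuous_flow A).comp continuous_neg).continuousOn.clm_apply hy
  have hAy : ContinuousOn (fun t => A (y t)) (Icc 0 1) := A.continuous.comp_continuousOn hy
  have hder : ∀ x ∈ Ico (0 : ℝ) 1, HasDerivWithinAt y (A (y x)) (Ici x) x := by
    intro x hx
    have hint : IntervalIntegrable (fun t => A (y t)) volume 0 x := by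
      apply ContinuousOn.intervalIntegrable
      rw [uIcc_of_le hx.1]
      exact hAy.mono (Icc_subset_Icc_right hx.2.le)
    have hcx : ContinuousWithinAt (fun t => A (y t)) (Icc x 1) x :=
      (hAy x ⟨hx.1, hx.2.le⟩).mono (Icc_subset_Icc_left hx.1)
    have hmem : Icc x 1 ∈ 𝓝[>] x := by
      exact Icc_mem_nhdsGT hx.2
    have h1 : HasDerivWithinAt (fun u => ∫ t in (0 : ℝ)..u, A (y t)) (A (y x)) (Ici x) x := by
      refine intervalIntegral.integral_hasDerivWithinAt_right hint (t := Ioi x) ?_ ?_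
      · exact ⟨Icc x 1, hmem, (hAy.mono (Icc_subset_Icc_left hx.1)).aestronglyMeasurable
          measurableSet_Icc⟩
      · exact hcx.mono_of_mem_nhdsWithin hmem
    refine (h1.const_add (y 0)).congr_of_eventuallyEq ?_ (h x ⟨hx.1, hx.2.le⟩)
    filter_upwards [Icc_mem_nhdsGE hx.2] with t ht
    exact h t ⟨hx.1.trans ht.1, ht.2⟩
  have hconst := constant_of_has_deriv_right_zero hc (fun x hx => by
    have := hasDerivWithinAt_complexCLM_apply
      ((hasDerivAt_flow_neg A x).hasDerivWithinAt (s := Ici x)) (hder x hx)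
    convert this using 1
    simp)
  intro x hx
  have h3 := congrArg (flow A x) (hconst x hx)
  rw [← mul_apply_eq_comp, flow_mul_neg] at h3
  simpa using h3

theorem integral_flow_eq (A : V →L[ℂ] V) (c : V) (x : ℝ) :
    flow A x c = c + ∫ t in (0 : ℝ)..x, A (flow A t c) := by
  have h := intervalIntegral.integral_eq_sub_of_hasDerivAt (f := fun t => flow A t c)
    (f' := fun t => A (flow A t c)) (a := 0) (b := x)
    (fun t _ => by
      simpa using hasDerivAt_complexCLM_apply (hasDerivAt_flow A t) (hasDerivAt_const t c))
    ((A.continuous.comp ((continuous_flow A).clm_apply continuous_const)).intervalIntegrable _ _)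
  rw [h]
  simp

/-- A solution of `y' = A y + F`, `y 0 = 0`, for integrable `F`. -/
def duhamel (A : V →L[ℂ] V) (F : ℝ → V) (x : ℝ) : V :=
  (∫ t in (0 : ℝ)..x, F t) +
    flow A x (∫ s in (0 : ℝ)..x, flow A (-s) (A (∫ t in (0 : ℝ)..s, F t)))

variable {F : ℝ → V}

theorem continuous_duhamel (A : V →L[ℂ] V) (hF : Integrable F) : Continuous (duhamel A F) := by
  have hH : Continuous fun x => ∫ t in (0 : ℝ)..x, F t :=
    intervalIntegral.continuous_primitive (fun _ _ => hF.intervalIntegrable) 0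
  have hG : Continuous fun s => flow A (-s) (A (∫ t in (0 : ℝ)..s, F t)) :=
    ((continuous_flow A).comp continuous_neg).clm_apply (A.continuous.comp hH)
  exact hH.add ((continuous_flow A).clm_apply
    (intervalIntegral.continuous_primitive (fun _ _ => hG.intervalIntegrable _ _) 0))

/-- With H the primitive of F, the second summand u of `duhamel` satisfies u' = A (u + H), whose
right side is continuous. So u can be differentiated classically although F is merely integrable. -/
theorem duhamel_eq (A : V →L[ℂ] V) (hF : Integrable F) (x : ℝ) :
    duhamel A F x = ∫ t in (0 : ℝ)..x, (A (duhamel A F t) + F t) := by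
  have hH : Continuous fun x => ∫ t in (0 : ℝ)..x, F t :=
    intervalIntegral.continuous_primitive (fun _ _ => hF.intervalIntegrable) 0
  have hG : Continuous fun s => flow A (-s) (A (∫ t in (0 : ℝ)..s, F t)) :=
    ((continuous_flow A).comp continuous_neg).clm_apply (A.continuous.comp hH)
  have hd : ∀ t : ℝ, HasDerivAt (fun x => flow A x
      (∫ s in (0 : ℝ)..x, flow A (-s) (A (∫ t in (0 : ℝ)..s, F t)))) (A (duhamel A F t)) t := by
    intro t
    have h1 := hasDerivAt_complexCLM_apply (hasDerivAt_flow A t)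
      (intervalIntegral.integral_hasDerivAt_right (hG.intervalIntegrable 0 t)
        (hG.stronglyMeasurableAtFilter _ _) hG.continuousAt)
    convert h1 using 1
    rw [← mul_apply_eq_comp (flow A t), flow_mul_neg]
    simp [duhamel, add_comm]
  have hcA : Continuous fun t => A (duhamel A F t) := A.continuous.comp (continuous_duhamel A hF)
  rw [intervalIntegral.integral_add (hcA.intervalIntegrable _ _) hF.intervalIntegrable,
    intervalIntegral.integral_eq_sub_of_hasDerivAt (fun t _ => hd t) (hcA.intervalIntegrable _ _)]
  simp [duhamel, add_comm]

theorem exists_bound_flow (A : V →L[ℂ] V) :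
    ∃ K, 0 ≤ K ∧ ∀ x ∈ Icc (-1 : ℝ) 1, ‖flow A x‖ ≤ K := by
  obtain ⟨K, hK⟩ := isCompact_Icc.exists_bound_of_continuousOn (continuous_flow A).continuousOn
    (s := Icc (-1 : ℝ) 1)
  exact ⟨K, (norm_nonneg _).trans (hK 0 (by norm_num)), hK⟩

/-- The constant does not depend on F; this is what makes the resolvent bounded. -/
theorem exists_bound_duhamel (A : V →L[ℂ] V) :
    ∃ K, 0 ≤ K ∧ ∀ F : ℝ → V, Integrable F → ∀ x ∈ Icc (0 : ℝ) 1,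
      ‖duhamel A F x‖ ≤ K * ∫ t, ‖F t‖ := by
  obtain ⟨K, hK0, hK⟩ := exists_bound_flow A
  refine ⟨1 + K * (K * ‖A‖), by positivity, fun F hF x hx => ?_⟩
  have hI : ∀ s ∈ Icc (0 : ℝ) 1, ‖∫ t in (0 : ℝ)..s, F t‖ ≤ ∫ t, ‖F t‖ := by
    intro s hs
    refine (intervalIntegral.norm_integral_le_integral_norm hs.1).trans ?_
    rw [intervalIntegral.integral_of_le hs.1]
    exact setIntegral_le_integral hF.norm (Eventually.of_forall fun t => norm_nonneg _)
  have hJ : ‖∫ s in (0 : ℝ)..x, flow A (-s) (A (∫ t in (0 : ℝ)..s, F t))‖ ≤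
      K * (‖A‖ * ∫ t, ‖F t‖) * |x - 0| := by
    apply intervalIntegral.norm_integral_le_of_norm_le_const
    intro s hs
    rw [uIoc_of_le hx.1] at hs
    have hs' : s ∈ Icc (0 : ℝ) 1 := ⟨hs.1.le, hs.2.trans hx.2⟩
    refine (ContinuousLinearMap.le_opNorm _ _).trans ?_
    gcongr
    · exact hK _ ⟨by linarith [hs'.2], by linarith [hs'.1]⟩
    · exact (ContinuousLinearMap.le_opNorm _ _).trans (by gcongr; exact hI s hs')
  have hL : 0 ≤ ∫ t, ‖F t‖ := integral_nonneg fun t => norm_nonneg _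
  have hx1 : |x - 0| ≤ 1 := by rw [sub_zero, abs_of_nonneg hx.1]; exact hx.2
  calc ‖duhamel A F x‖ ≤ (∫ t, ‖F t‖) + K * (K * (‖A‖ * ∫ t, ‖F t‖) * 1) := by
        refine (norm_add_le _ _).trans (add_le_add (hI x hx) ?_)
        refine (ContinuousLinearMap.le_opNorm _ _).trans ?_
        gcongr
        · exact hK _ ⟨by linarith [hx.1], hx.2⟩
        · exact hJ.trans (by gcongr)
    _ = _ := by ring

end LinearODE

/-! ### Fixed points of holomorphic contractions -/

/-- A holomorphic perturbation `a + f` of a constant which is small compared with the size of its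
domain has exactly one fixed point near `a`. -/
theorem existsUnique_fixedPoint {f : ℂ → ℂ} {a : ℂ} {r b : ℝ} (hr : 0 < r)
    (hf : DifferentiableOn ℂ f (Metric.ball a (3 * r)))
    (hb : ∀ z ∈ Metric.ball a (3 * r), ‖f z‖ ≤ b) (hbr : b ≤ r / 2) :
    ∃ z ∈ Metric.closedBall a r, z = a + f z ∧
      ∀ w ∈ Metric.closedBall a r, w = a + f w → w = z := by
  have hsub : ∀ z ∈ Metric.closedBall a r, Metric.closedBall z r ⊆ Metric.ball a (3 * r) := by
    intro z hz
    apply Metric.closedBall_subset_ball'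
    rw [Metric.mem_closedBall] at hz
    linarith
  have hmem : Metric.closedBall a r ⊆ Metric.ball a (3 * r) :=
    Metric.closedBall_subset_ball (by linarith)
  -- Cauchy's estimate on discs of radius r, which stay inside the ball of radius 3r, gives |f'| ≤
  -- (r/2)/r = 1/2.
  have hderiv : ∀ z ∈ Metric.closedBall a r, ‖deriv f z‖ ≤ ((1 / 2 : NNReal) : ℝ) := by
    intro z hz
    have h1 : DiffContOnCl ℂ f (Metric.ball z r) := by
      apply DifferentiableOn.diffContOnCl
      rw [closure_ball z hr.ne']
      exact hf.mono (hsub z hz)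
    have h2 := Complex.norm_deriv_le_of_forall_mem_sphere_norm_le hr h1
      (fun w hw => (hb w (hsub z hz (Metric.sphere_subset_closedBall hw))).trans hbr)
    refine h2.trans ?_
    rw [div_div, mul_comm, ← div_div, div_self hr.ne']
    norm_num
  have hlip : LipschitzOnWith (1 / 2) f (Metric.closedBall a r) :=
    (convex_closedBall a r).lipschitzOnWith_of_nnnorm_deriv_le
      (fun z hz => hf.differentiableAt (Metric.isOpen_ball.mem_nhds (hmem hz))) hderiv
  have hlip' : LipschitzOnWith (1 / 2) (fun z => a + f z) (Metric.closedBall a r) := by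
    intro x hx y hy
    simpa using hlip hx hy
  have hmaps : MapsTo (fun z => a + f z) (Metric.closedBall a r) (Metric.closedBall a r) := by
    intro z hz
    rw [mem_closedBall_iff_norm]
    have := hb z (hmem hz)
    simp only [add_sub_cancel_left]
    linarith
  have hcontr : ContractingWith (1 / 2) (hmaps.restrict _ _ _) :=
    ⟨by rw [← NNReal.coe_lt_coe]; norm_num, hlip'.mapsToRestrict hmaps⟩
  obtain ⟨z, hz, hfix, -⟩ := hcontr.exists_fixedPoint' Metric.isClosed_closedBall.isComplete hmaps
    (Metric.mem_closedBall_self hr.le) (edist_ne_top _ _)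
  refine ⟨z, hz, hfix.eq.symm, fun w hw hwf => ?_⟩
  have h1 := hlip'.dist_le_mul w hw z hz
  simp only [← hwf] at h1
  rw [show a + f z = z from hfix] at h1
  have h2 : ((1 / 2 : NNReal) : ℝ) = 1 / 2 := by norm_num
  rw [h2] at h1
  exact dist_le_zero.1 (by linarith [dist_nonneg (x := w) (y := z)])

/-! ### The boundary value problem as a first order system -/

instance : IsProbabilityMeasure mu := ⟨by simp [mu]⟩

theorem IsH1.continuousOn {u u' : L2} {U : ℝ → ℂ} (h : IsH1 u u' U) :
    ContinuousOn U (Icc (0 : ℝ) 1) := by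
  have h1 := intervalIntegral.continuousOn_primitive_interval' (intervalIntegrable_L2 u')
    left_mem_uIcc
  rw [uIcc_of_le zero_le_one] at h1
  exact (continuousOn_const.add h1).congr h.eq_integral

theorem memLp_of_continuousOn {u : ℝ → ℂ} (hu : ContinuousOn u (Icc (0 : ℝ) 1)) :
    MemLp u 2 mu := by
  obtain ⟨C, hC⟩ := isCompact_Icc.exists_bound_of_continuousOn hu
  refine MemLp.of_bound ((hu.mono Ioo_subset_Icc_self).aestronglyMeasurable measurableSet_Ioo) C ?_
  exact (ae_restrict_iff' measurableSet_Ioo).2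
    (Eventually.of_forall fun x hx => hC x (Ioo_subset_Icc_self hx))

theorem ae_mu_of_forall {p : ℝ → Prop} (h : ∀ x ∈ Icc (0 : ℝ) 1, p x) : ∀ᵐ x ∂mu, p x :=
  (ae_restrict_iff' measurableSet_Ioo).2
    (Eventually.of_forall fun x hx => h x (Ioo_subset_Icc_self hx))

theorem eqOn_zero_of_ae_eq_zero {u : ℝ → ℂ} (hu : ContinuousOn u (Icc (0 : ℝ) 1))
    (h : u =ᵐ[mu] 0) : ∀ x ∈ Icc (0 : ℝ) 1, u x = 0 := by
  have h1 : EqOn u 0 (Ioo (0 : ℝ) 1) :=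
    Measure.eqOn_open_of_ae_eq h isOpen_Ioo (hu.mono Ioo_subset_Icc_self) continuousOn_const
  have h2 : EqOn u 0 (Icc (0 : ℝ) 1) :=
    h1.of_subset_closure hu continuousOn_const Ioo_subset_Icc_self
      (by rw [closure_Ioo zero_ne_one])
  exact h2

theorem integral_norm_le_L2 (f : L2) : ∫ t, ‖f t‖ ∂mu ≤ ‖f‖ := by
  have h1 : eLpNorm f 1 mu ≤ eLpNorm f 2 mu :=
    eLpNorm_le_eLpNorm_of_exponent_le (by norm_num) (Lp.aestronglyMeasurable f)
  rw [← ENNReal.toReal_le_toReal (((Lp.memLp f).mono_exponent (by norm_num)).eLpNorm_ne_top)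
    (Lp.eLpNorm_ne_top f), eLpNorm_one_eq_lintegral_enorm] at h1
  rw [integral_norm_eq_lintegral_enorm (Lp.aestronglyMeasurable f)]
  exact h1

/-- The matrix of the first order system for `(ξ, η, η', ∫ ξ)`. -/
def sysMatrix (z : ℂ) : Matrix (Fin 4) (Fin 4) ℂ :=
  !![z, 0, -1, 0; 0, 0, 1, 0; -z, z, 0, 0; 1, 0, 0, 0]

/-- The operator of the first order system for `(ξ, η, η', ∫ ξ)`. -/
def sysOp (z : ℂ) : (Fin 4 → ℂ) →L[ℂ] (Fin 4 → ℂ) :=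
  LinearMap.toContinuousLinearMap (Matrix.toLin' (sysMatrix z))

theorem sysOp_apply (z : ℂ) (y : Fin 4 → ℂ) :
    sysOp z y = ![z * y 0 - y 2, y 2, z * y 1 - z * y 0, y 0] := by
  ext i
  fin_cases i <;>
    simp [sysOp, sysMatrix, Matrix.mulVec, dotProduct, Fin.sum_univ_four] <;> ring

theorem intervalIntegral_pi_apply {φ : ℝ → Fin 4 → ℂ} {a b : ℝ}
    (h : IntervalIntegrable φ volume a b) (i : Fin 4) :
    (∫ t in a..b, φ t) i = ∫ t in a..b, φ t i :=
  ((ContinuousLinearMap.proj (R := ℂ) (φ := fun _ : Fin 4 => ℂ) i).intervalIntegral_comp_comm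
    h).symm

/-- The two equations give ξ' = zξ - η' and, by subtraction, η'' = zη - zξ. The fourth component,
the primitive of ξ, turns the mean-zero condition into a boundary condition. -/
theorem exists_solution_of_mem_adjointGraph {z : ℂ} {Φ : State} (h : (Φ, z • Φ) ∈ adjointGraph) :
    ∃ y : ℝ → Fin 4 → ℂ, ContinuousOn y (Icc 0 1) ∧
      (∀ x ∈ Icc (0 : ℝ) 1, y x = y 0 + ∫ t in (0 : ℝ)..x, sysOp z (y t)) ∧
      y 0 1 = 0 ∧ y 0 3 = 0 ∧ y 1 1 = 0 ∧ y 1 3 = 0 ∧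
      (Φ.1 : L2) =ᵐ[mu] (fun x => y x 0) ∧ Φ.2 =ᵐ[mu] (fun x => y x 1) := by
  obtain ⟨ξ', η', η'', X, Y, Y', hX, hY, hY', hX01, hY0, hY1, hf, hg⟩ := h
  simp only [Prod.smul_fst, Prod.smul_snd, Submodule.coe_smul] at hf hg hX hY
  have hcX := hX.continuousOn
  have hcY := hY.continuousOn
  have hcY' := hY'.continuousOn
  have hiX : IntervalIntegrable X volume 0 1 := by
    apply ContinuousOn.intervalIntegrable
    rwa [uIcc_of_le zero_le_one]
  have hcT : ContinuousOn (fun x => ∫ t in (0 : ℝ)..x, X t) (Icc 0 1) := by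
    have := intervalIntegral.continuousOn_primitive_interval' hiX left_mem_uIcc
    rwa [uIcc_of_le zero_le_one] at this
  have e1 : ξ' =ᵐ[mu] fun t => z * X t - Y' t := by
    have e : ξ' = z • (Φ.1 : L2) - η' := by rw [hf]; abel
    rw [e]
    filter_upwards [Lp.coeFn_sub (z • (Φ.1 : L2)) η', Lp.coeFn_smul z (Φ.1 : L2), hX.ae_eq,
      hY'.ae_eq] with t h1 h2 h3 h4
    simp only [h1, h2, h3, h4, Pi.sub_apply, Pi.smul_apply, smul_eq_mul]
  have e2 : η'' =ᵐ[mu] fun t => z * Y t - z * X t := by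
    have e : η'' = z • Φ.2 - z • (Φ.1 : L2) := by rw [hf, hg]; abel
    rw [e]
    filter_upwards [Lp.coeFn_sub (z • Φ.2) (z • (Φ.1 : L2)), Lp.coeFn_smul z (Φ.1 : L2),
      Lp.coeFn_smul z Φ.2, hX.ae_eq, hY.ae_eq] with t h1 h2 h3 h4 h5
    simp only [h1, h2, h3, h4, h5, Pi.sub_apply, Pi.smul_apply, smul_eq_mul]
  have hcy : ContinuousOn (fun x => ![X x, Y x, Y' x, ∫ t in (0 : ℝ)..x, X t]) (Icc 0 1) := by
    rw [continuousOn_pi]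
    intro i
    fin_cases i
    · exact hcX
    · exact hcY
    · exact hcY'
    · exact hcT
  refine ⟨fun x => ![X x, Y x, Y' x, ∫ t in (0 : ℝ)..x, X t], hcy, ?_, ?_, ?_, ?_, ?_, ?_, ?_⟩
  · intro x hx
    have hint : IntervalIntegrable (fun t => sysOp z ![X t, Y t, Y' t, ∫ s in (0 : ℝ)..t, X s])
        volume 0 x := by
      apply ContinuousOn.intervalIntegrable
      rw [uIcc_of_le hx.1]
      exact (sysOp z).continuous.comp_continuousOn (hcy.mono (Icc_subset_Icc_right hx.2))
    ext i
    rw [Pi.add_apply, intervalIntegral_pi_apply hint]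
    simp only [sysOp_apply]
    fin_cases i
    · simpa [← intervalIntegral_congr_L2 e1 hx] using hX.eq_integral x hx
    · simpa [← intervalIntegral_congr_L2 hY'.ae_eq hx] using hY.eq_integral x hx
    · simpa [← intervalIntegral_congr_L2 e2 hx] using hY'.eq_integral x hx
    · simp
  · simpa using hY0
  · simp
  · simpa using hY1
  · have h1 := Φ.1.2
    have h2 : ∫ t, (Φ.1 : L2) t ∂mu = 0 := h1
    rw [integral_congr_ae hX.ae_eq, ← integral_Ioc_eq_integral_Ioo,
      ← intervalIntegral.integral_of_le zero_le_one] at h2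
    simpa using h2
  · simpa using hX.ae_eq
  · simpa using hY.ae_eq

/-- Converse direction with a source: zΦ - A*Φ = (f, g) amounts to ξ' = zξ - η' - f and η'' = zη -
zξ + f - g, which fixes the shape of F. The case F = 0 produces eigenfunctions, the general case the
resolvent. -/
theorem exists_mem_adjointGraph_of_solution {z : ℂ} {f : meanZero} {g : L2}
    {F y : ℝ → Fin 4 → ℂ} (hFi : Integrable F)
    (hF : F =ᵐ[mu] fun t => ![-(f : L2) t, 0, (f : L2) t - g t, 0])
    (hy : ContinuousOn y (Icc 0 1))
    (h : ∀ x ∈ Icc (0 : ℝ) 1, y x = y 0 + ∫ t in (0 : ℝ)..x, (sysOp z (y t) + F t))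
    (h01 : y 0 1 = 0) (h03 : y 0 3 = 0) (h11 : y 1 1 = 0) (h13 : y 1 3 = 0) :
    ∃ Φ : State, (Φ, z • Φ - (f, g)) ∈ adjointGraph ∧
      (Φ.1 : L2) =ᵐ[mu] (fun x => y x 0) ∧ Φ.2 =ᵐ[mu] (fun x => y x 1) := by
  have hcy : ∀ i, ContinuousOn (fun x => y x i) (Icc 0 1) := continuousOn_pi.1 hy
  have hL : ∀ i, MemLp (fun x => y x i) 2 mu := fun i => memLp_of_continuousOn (hcy i)
  have hcomp : ∀ x ∈ Icc (0 : ℝ) 1, ∀ i,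
      y x i = y 0 i + ∫ t in (0 : ℝ)..x, (sysOp z (y t) i + F t i) := by
    intro x hx i
    have hint : IntervalIntegrable (fun t => sysOp z (y t) + F t) volume 0 x := by
      refine IntervalIntegrable.add ?_ hFi.intervalIntegrable
      apply ContinuousOn.intervalIntegrable
      rw [uIcc_of_le hx.1]
      exact (sysOp z).continuous.comp_continuousOn (hy.mono (Icc_subset_Icc_right hx.2))
    have h1 := congrFun (h x hx) i
    rwa [Pi.add_apply, intervalIntegral_pi_apply hint] at h1
  have hmean : ∫ t, (hL 0).toLp (fun x => y x 0) t ∂mu = 0 := by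
    rw [integral_congr_ae (hL 0).coeFn_toLp, ← integral_Ioc_eq_integral_Ioo,
      ← intervalIntegral.integral_of_le zero_le_one]
    have h3 := hcomp 1 (by simp) 3
    rw [h13, h03, zero_add] at h3
    rw [h3]
    apply intervalIntegral_congr_L2 _ (by simp)
    filter_upwards [hF] with t ht
    simp [ht, sysOp_apply]
  set ξ : L2 := (hL 0).toLp (fun x => y x 0) with hξ
  set η : L2 := (hL 1).toLp (fun x => y x 1) with hη
  set η' : L2 := (hL 2).toLp (fun x => y x 2) with hη'
  have a0 : ξ =ᵐ[mu] fun x => y x 0 := (hL 0).coeFn_toLp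
  have a1 : η =ᵐ[mu] fun x => y x 1 := (hL 1).coeFn_toLp
  have a2 : η' =ᵐ[mu] fun x => y x 2 := (hL 2).coeFn_toLp
  have e1 : (z • ξ - η' - f : L2) =ᵐ[mu] fun t => sysOp z (y t) 0 + F t 0 := by
    filter_upwards [Lp.coeFn_sub (z • ξ - η') (f : L2), Lp.coeFn_sub (z • ξ) η',
      Lp.coeFn_smul z ξ, a0, a2, hF] with t h1 h2 h3 h4 h5 h6
    simp only [h1, h2, h3, h4, h5, h6, sysOp_apply, Pi.sub_apply, Pi.smul_apply, smul_eq_mul]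
    simp
    ring
  have e2 : (z • η - z • ξ + (f - g) : L2) =ᵐ[mu] fun t => sysOp z (y t) 2 + F t 2 := by
    filter_upwards [Lp.coeFn_add (z • η - z • ξ) ((f : L2) - g), Lp.coeFn_sub (z • η) (z • ξ),
      Lp.coeFn_smul z ξ, Lp.coeFn_smul z η, Lp.coeFn_sub (f : L2) g, a0, a1, hF]
      with t h1 h2 h3 h4 h5 h6 h7 h8
    simp only [h1, h2, h3, h4, h5, h6, h7, h8, sysOp_apply, Pi.sub_apply, Pi.add_apply,
      Pi.smul_apply, smul_eq_mul, Matrix.cons_val]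
  have hX : IsH1 ξ (z • ξ - η' - f) (fun x => y x 0) :=
    ⟨a0, fun x hx => by rw [intervalIntegral_congr_L2 e1 hx]; exact hcomp x hx 0⟩
  have hY : IsH1 η η' (fun x => y x 1) := by
    refine ⟨a1, fun x hx => ?_⟩
    rw [hcomp x hx 1]
    congr 1
    apply intervalIntegral_congr_L2 _ hx
    filter_upwards [a2, hF] with t h1 h2
    simp [h1, h2, sysOp_apply]
  have hY' : IsH1 η' (z • η - z • ξ + (f - g)) (fun x => y x 2) :=
    ⟨a2, fun x hx => by rw [intervalIntegral_congr_L2 e2 hx]; exact hcomp x hx 2⟩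
  refine ⟨(⟨ξ, hmean⟩, η), ⟨_, _, _, _, _, _, hX, hY, hY', ?_, h01, h11, ?_, ?_⟩, a0, a1⟩
  -- Periodicity of ξ comes from integrating ξ' = zξ - η' - f over (0,1): ξ and f have mean zero,
  -- and ∫η' = η(1) - η(0) = 0.
  · have hfi : ∫ t in (0 : ℝ)..1, (f : L2) t = 0 := by
      have : ∫ t, (f : L2) t ∂mu = 0 := f.2
      rwa [← integral_Ioc_eq_integral_Ioo, ← intervalIntegral.integral_of_le zero_le_one] at this
    have hξi : ∫ t in (0 : ℝ)..1, ξ t = 0 := by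
      rwa [← integral_Ioc_eq_integral_Ioo,
        ← intervalIntegral.integral_of_le zero_le_one] at hmean
    have hη'i : ∫ t in (0 : ℝ)..1, η' t = 0 := by
      have := hY.eq_integral 1 (by simp)
      simpa [h01, h11] using this.symm
    have h1 := hX.eq_integral 1 (by simp)
    have h2 : ∫ t in (0 : ℝ)..1, (z • ξ - η' - f : L2) t =
        ∫ t in (0 : ℝ)..1, (z * ξ t - η' t - (f : L2) t) := by
      apply intervalIntegral_congr_L2 _ (by simp)
      filter_upwards [Lp.coeFn_sub (z • ξ - η') (f : L2), Lp.coeFn_sub (z • ξ) η',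
        Lp.coeFn_smul z ξ] with t k1 k2 k3
      simp only [k1, k2, k3, Pi.sub_apply, Pi.smul_apply, smul_eq_mul]
    rw [h2, intervalIntegral.integral_sub
        (((intervalIntegrable_L2 ξ).const_mul z).sub (intervalIntegrable_L2 η'))
        (intervalIntegrable_L2 (f : L2)),
      intervalIntegral.integral_sub ((intervalIntegrable_L2 ξ).const_mul z)
        (intervalIntegrable_L2 η'), intervalIntegral.integral_const_mul, hξi, hη'i, hfi] at h1
    simpa using h1.symm
  · simp only [Prod.smul_mk, Prod.mk_sub_mk, Submodule.coe_sub, Submodule.coe_smul]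
    abel
  · simp only [Prod.smul_mk, Prod.mk_sub_mk]
    abel

/-! ### The characteristic function and the spectrum -/

/-- Initial data `(ξ₀, 0, ζ₀, 0)` of the first order system. -/
def initialData : (Fin 2 → ℂ) →ₗ[ℂ] (Fin 4 → ℂ) where
  toFun c := ![c 0, 0, c 1, 0]
  map_add' c d := by ext i; fin_cases i <;> simp
  map_smul' a c := by ext i; fin_cases i <;> simp

theorem initialData_apply (c : Fin 2 → ℂ) : initialData c = ![c 0, 0, c 1, 0] := rfl

/-- The matrix mapping `(ξ₀, ζ₀)` to the boundary values `(η(1), ∫ ξ)`. -/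
def bdryMatrix (z : ℂ) : Matrix (Fin 2) (Fin 2) ℂ :=
  !![flow (sysOp z) 1 ![1, 0, 0, 0] 1, flow (sysOp z) 1 ![0, 0, 1, 0] 1;
     flow (sysOp z) 1 ![1, 0, 0, 0] 3, flow (sysOp z) 1 ![0, 0, 1, 0] 3]

/-- The characteristic function, whose zeros are the eigenvalues. -/
def charDet (z : ℂ) : ℂ := (bdryMatrix z).det

theorem bdryMatrix_mulVec (z : ℂ) (c : Fin 2 → ℂ) :
    (bdryMatrix z).mulVec c =
      ![flow (sysOp z) 1 (initialData c) 1, flow (sysOp z) 1 (initialData c) 3] := by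
  have h : initialData c = c 0 • ![1, 0, 0, 0] + c 1 • ![0, 0, 1, 0] := by
    ext i; fin_cases i <;> simp [initialData_apply]
  rw [h, map_add, map_smul, map_smul]
  ext i
  fin_cases i <;> simp [bdryMatrix, Matrix.mulVec, dotProduct, mul_comm]

theorem charDet_eq_zero_iff (z : ℂ) :
    charDet z = 0 ↔ ∃ c : Fin 2 → ℂ, c ≠ 0 ∧ flow (sysOp z) 1 (initialData c) 1 = 0 ∧
      flow (sysOp z) 1 (initialData c) 3 = 0 := by
  rw [charDet, ← Matrix.exists_mulVec_eq_zero_iff]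
  simp only [bdryMatrix_mulVec]
  refine exists_congr fun c => and_congr_right fun _ => ?_
  constructor
  · intro h
    exact ⟨by simpa using congrFun h 0, by simpa using congrFun h 1⟩
  · rintro ⟨h1, h2⟩
    ext i; fin_cases i <;> simp [h1, h2]

theorem eq_zero_of_charDet_ne_zero {z : ℂ} (hz : charDet z ≠ 0) {Φ : State}
    (h : (Φ, z • Φ) ∈ adjointGraph) : Φ = 0 := by
  obtain ⟨y, hc, hy, h01, h03, h11, h13, hξ, hη⟩ := exists_solution_of_mem_adjointGraph h
  have hflow := eq_flow_of_integral_eq _ hc hy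
  have hini : y 0 = initialData ![y 0 0, y 0 2] := by
    ext i; fin_cases i <;> simp [initialData_apply, h01, h03]
  have hy0 : y 0 = 0 := by
    by_contra hne
    apply hz
    rw [charDet_eq_zero_iff]
    refine ⟨![y 0 0, y 0 2], fun h0 => hne ?_, ?_, ?_⟩
    · rw [hini, h0, map_zero]
    · rw [← hini, ← hflow 1 (by simp), h11]
    · rw [← hini, ← hflow 1 (by simp), h13]
  have hyx : ∀ x ∈ Icc (0 : ℝ) 1, y x = 0 := fun x hx => by rw [hflow x hx, hy0, map_zero]
  have hΦ1 : (Φ.1 : L2) = 0 := by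
    rw [Lp.eq_zero_iff_ae_eq_zero]
    filter_upwards [hξ, ae_mu_of_forall hyx] with x h1 h2
    simp [h1, h2]
  have hΦ2 : Φ.2 = 0 := by
    rw [Lp.eq_zero_iff_ae_eq_zero]
    filter_upwards [hη, ae_mu_of_forall hyx] with x h1 h2
    simp [h1, h2]
  exact Prod.ext (Subtype.ext hΦ1) hΦ2

theorem mem_eigenvalues_iff_charDet (z : ℂ) :
    z ∈ eigenvalues adjointOp ↔ charDet z = 0 := by
  rw [mem_eigenvalues_adjointOp_iff]
  constructor
  · rintro ⟨Φ, hΦ, h⟩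
    by_contra hz
    exact hΦ (eq_zero_of_charDet_ne_zero hz h)
  · intro hz
    obtain ⟨c, hc, h1, h3⟩ := (charDet_eq_zero_iff z).1 hz
    set y : ℝ → Fin 4 → ℂ := fun x => flow (sysOp z) x (initialData c) with hydef
    have hycont : Continuous y := (continuous_flow _).clm_apply continuous_const
    have hy0 : y 0 = initialData c := by simp [hydef]
    obtain ⟨Φ, hΦ, hξ, hη⟩ := exists_mem_adjointGraph_of_solution (z := z) (f := 0) (g := 0)
      (F := 0) (y := y) (integrable_zero _ _ _)
      (by
        filter_upwards [Lp.coeFn_zero ℂ 2 mu] with t ht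
        simp only [Submodule.coe_zero, ht]
        ext i; fin_cases i <;> simp)
      hycont.continuousOn
      (fun x _ => by
        rw [hy0]
        simpa using integral_flow_eq (sysOp z) (initialData c) x)
      (by simp [hy0, initialData_apply]) (by simp [hy0, initialData_apply]) h1 h3
    refine ⟨Φ, ?_, by convert hΦ using 2; exact (sub_zero _).symm⟩
    rintro rfl
    -- If Φ were zero, the continuous functions ξ and η would vanish on all of [0,1]. Then ξ(0) = 0
    -- and η'(0) = 0, so the initial data would vanish.
    have hcomp : ∀ i, Continuous fun x => y x i := fun i => (continuous_apply i).comp hycont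
    have z0 := eqOn_zero_of_ae_eq_zero (hcomp 0).continuousOn
      (hξ.symm.trans (Lp.coeFn_zero ℂ 2 mu)) 0 (by simp)
    have z1 := eqOn_zero_of_ae_eq_zero (hcomp 1).continuousOn
      (hη.symm.trans (Lp.coeFn_zero ℂ 2 mu))
    have hd : HasDerivAt y (sysOp z (y 0)) 0 := by
      have := hasDerivAt_complexCLM_apply (hasDerivAt_flow (sysOp z) 0)
        (hasDerivAt_const 0 (initialData c))
      simpa [hy0] using this
    have hd1 : HasDerivWithinAt (fun x => y x 1) (y 0 2) (Icc 0 1) 0 := by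
      have := hasDerivAt_pi.1 hd 1
      simpa [sysOp_apply] using this.hasDerivWithinAt
    have hd2 : HasDerivWithinAt (fun x => y x 1) 0 (Icc 0 1) 0 :=
      (hasDerivWithinAt_const (0 : ℝ) (Icc (0 : ℝ) 1) (0 : ℂ)).congr z1 (z1 0 (by simp))
    have z2 : y 0 2 = 0 :=
      (uniqueDiffOn_Icc zero_lt_one 0 (by simp)).eq_deriv _ hd1 hd2
    apply hc
    rw [hy0] at z0 z2
    ext i
    fin_cases i
    · simpa [initialData_apply] using z0
    · simpa [initialData_apply] using z2

/-- The source term of the resolvent equation, extended by zero. -/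
def source (f g : L2) : ℝ → Fin 4 → ℂ :=
  (Ioo (0 : ℝ) 1).indicator fun t => ![-f t, 0, f t - g t, 0]

theorem source_ae_eq (f g : L2) : source f g =ᵐ[mu] fun t => ![-f t, 0, f t - g t, 0] :=
  indicator_ae_eq_restrict measurableSet_Ioo

theorem integrable_source (f g : L2) : Integrable (source f g) := by
  rw [source, integrable_indicator_iff measurableSet_Ioo]
  refine Integrable.of_eval fun i => ?_
  fin_cases i
  · exact (integrable_L2 f).neg
  · exact integrable_zero _ _ _
  · exact (integrable_L2 f).sub (integrable_L2 g)
  · exact integrable_zero _ _ _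

theorem integral_norm_source_le (f g : L2) : ∫ t, ‖source f g t‖ ≤ ‖f‖ + ‖g‖ := by
  have h1 : ∀ t, ‖source f g t‖ = (Ioo (0 : ℝ) 1).indicator
      (fun t => ‖(![-f t, 0, f t - g t, 0] : Fin 4 → ℂ)‖) t := fun t =>
    norm_indicator_eq_indicator_norm _ _
  simp_rw [h1]
  rw [integral_indicator measurableSet_Ioo]
  have hi := (integrable_indicator_iff measurableSet_Ioo).1 (integrable_source f g)
  calc ∫ t, ‖(![-f t, 0, f t - g t, 0] : Fin 4 → ℂ)‖ ∂mu ≤ ∫ t, (‖f t‖ + ‖g t‖) ∂mu := by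
        refine integral_mono hi.norm ((integrable_L2 f).norm.add (integrable_L2 g).norm) fun t => ?_
        refine (pi_norm_le_iff_of_nonneg (by positivity)).2 fun i => ?_
        fin_cases i
        · simp
        · simp; positivity
        · simpa using norm_sub_le _ _
        · simp; positivity
    _ = (∫ t, ‖f t‖ ∂mu) + ∫ t, ‖g t‖ ∂mu :=
        integral_add (integrable_L2 f).norm (integrable_L2 g).norm
    _ ≤ _ := add_le_add (integral_norm_le_L2 f) (integral_norm_le_L2 g)

theorem norm_L2_le {f : L2} {C : ℝ} (hC : 0 ≤ C) (h : ∀ᵐ x ∂mu, ‖f x‖ ≤ C) : ‖f‖ ≤ C := by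
  simpa [measureUnivNNReal] using Lp.norm_le_of_ae_bound hC h

/-- The Duhamel solution satisfies the conditions at 0. Adding a homogeneous solution, found by
inverting the boundary matrix, corrects its values at 1. Every ingredient is bounded by the L¹ norm
of the source, hence by the norm of (f, g). -/
theorem mem_resolventSet_of_charDet_ne_zero {z : ℂ} (hz : charDet z ≠ 0) :
    z ∈ resolventSet adjointOp := by
  obtain ⟨K, hK0, hK⟩ := exists_bound_flow (sysOp z)
  obtain ⟨K', hK'0, hK'⟩ := exists_bound_duhamel (sysOp z)
  set B : (Fin 2 → ℂ) →L[ℂ] (Fin 2 → ℂ) :=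
    LinearMap.toContinuousLinearMap (Matrix.toLin' (bdryMatrix z)⁻¹) with hB
  set J : (Fin 2 → ℂ) →L[ℂ] (Fin 4 → ℂ) := LinearMap.toContinuousLinearMap initialData with hJ
  refine mem_resolventSet_adjointOp z ((K' + K * (‖J‖ * (‖B‖ * K'))) * 2)
    (fun Φ h => eq_zero_of_charDet_ne_zero hz h) ?_
  rintro ⟨f, g⟩
  set F := source f g with hF
  have hFi : Integrable F := integrable_source f g
  set w : Fin 2 → ℂ := ![duhamel (sysOp z) F 1 1, duhamel (sysOp z) F 1 3] with hw
  -- The homogeneous solution with these data has boundary values -w, cancelling those of the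
  -- Duhamel term.
  set c : Fin 2 → ℂ := -B w with hc
  have hBc : (bdryMatrix z).mulVec c = -w := by
    have h1 : B w = (bdryMatrix z)⁻¹.mulVec w := by simp [hB]
    rw [hc, h1, Matrix.mulVec_neg, Matrix.mulVec_mulVec,
      Matrix.mul_nonsing_inv _ (isUnit_iff_ne_zero.2 hz), Matrix.one_mulVec]
  rw [bdryMatrix_mulVec] at hBc
  have hb1 : flow (sysOp z) 1 (initialData c) 1 = -duhamel (sysOp z) F 1 1 := by
    simpa [hw] using congrFun hBc 0
  have hb3 : flow (sysOp z) 1 (initialData c) 3 = -duhamel (sysOp z) F 1 3 := by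
    simpa [hw] using congrFun hBc 1
  set y : ℝ → Fin 4 → ℂ := fun x => flow (sysOp z) x (initialData c) + duhamel (sysOp z) F x
    with hy
  have hc1 : Continuous fun x => flow (sysOp z) x (initialData c) :=
    (continuous_flow _).clm_apply continuous_const
  have hc2 : Continuous (duhamel (sysOp z) F) := continuous_duhamel _ hFi
  have hy0 : y 0 = initialData c := by simp [hy, duhamel]
  obtain ⟨Φ, hΦ, hξ, hη⟩ := exists_mem_adjointGraph_of_solution (z := z) (f := f) (g := g)
    (F := F) (y := y) hFi (source_ae_eq f g) (hc1.add hc2).continuousOn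
    (fun x _ => by
      have i1 : IntervalIntegrable (fun t => sysOp z (flow (sysOp z) t (initialData c))) volume
          0 x := ((sysOp z).continuous.comp hc1).intervalIntegrable _ _
      have i2 : IntervalIntegrable (fun t => sysOp z (duhamel (sysOp z) F t)) volume 0 x :=
        ((sysOp z).continuous.comp hc2).intervalIntegrable _ _
      rw [hy0]
      simp only [hy, map_add, add_assoc]
      rw [intervalIntegral.integral_add i1 (i2.add hFi.intervalIntegrable), ← add_assoc,
        ← integral_flow_eq, ← duhamel_eq _ hFi])
    (by simp [hy0, initialData_apply]) (by simp [hy0, initialData_apply])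
    (by simp [hy, hb1]) (by simp [hy, hb3])
  refine ⟨Φ, hΦ, ?_⟩
  set L := ∫ t, ‖F t‖ with hL
  have hL0 : 0 ≤ L := integral_nonneg fun t => norm_nonneg _
  have hL1 : L ≤ 2 * ‖((f, g) : State)‖ := by
    have h1 : ‖(f : L2)‖ ≤ ‖((f, g) : State)‖ := norm_fst_le ((f, g) : State)
    have h2 : ‖g‖ ≤ ‖((f, g) : State)‖ := norm_snd_le ((f, g) : State)
    exact (integral_norm_source_le f g).trans (by linarith)
  have hwb : ‖w‖ ≤ K' * L := by
    refine (pi_norm_le_iff_of_nonneg (by positivity)).2 fun i => ?_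
    have := hK' F hFi 1 (by simp)
    fin_cases i
    · exact (norm_le_pi_norm (duhamel (sysOp z) F 1) 1).trans this
    · exact (norm_le_pi_norm (duhamel (sysOp z) F 1) 3).trans this
  have hyb : ∀ x ∈ Icc (0 : ℝ) 1, ‖y x‖ ≤ (K' + K * (‖J‖ * (‖B‖ * K'))) * L := by
    intro x hx
    have b1 : ‖initialData c‖ ≤ ‖J‖ * (‖B‖ * (K' * L)) := by
      refine (J.le_opNorm c).trans ?_
      gcongr
      rw [hc, norm_neg]
      exact (B.le_opNorm w).trans (by gcongr)
    have b2 : ‖flow (sysOp z) x (initialData c)‖ ≤ K * (‖J‖ * (‖B‖ * (K' * L))) := by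
      refine (ContinuousLinearMap.le_opNorm _ _).trans ?_
      gcongr
      exact hK x ⟨by linarith [hx.1], hx.2⟩
    refine (norm_add_le _ _).trans ?_
    linarith [hK' F hFi x hx]
  have hfin : (K' + K * (‖J‖ * (‖B‖ * K'))) * L ≤
      (K' + K * (‖J‖ * (‖B‖ * K'))) * 2 * ‖((f, g) : State)‖ := by
    rw [mul_assoc]
    gcongr
  have key : ∀ i, ∀ x ∈ Icc (0 : ℝ) 1, ‖y x i‖ ≤
      (K' + K * (‖J‖ * (‖B‖ * K'))) * 2 * ‖((f, g) : State)‖ := fun i x hx =>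
    (norm_le_pi_norm _ i).trans ((hyb x hx).trans hfin)
  rw [Prod.norm_def]
  refine max_le ?_ ?_
  · change ‖(Φ.1 : L2)‖ ≤ _
    refine norm_L2_le (by positivity) ?_
    filter_upwards [hξ, ae_mu_of_forall (key 0)] with x h1 h2
    rwa [h1]
  · refine norm_L2_le (by positivity) ?_
    filter_upwards [hη, ae_mu_of_forall (key 1)] with x h1 h2
    rwa [h1]

theorem spectrum_adjointOp_eq : spectrum adjointOp = {z | charDet z = 0} := by
  ext z
  constructor
  · intro h
    by_contra hz
    exact h (mem_resolventSet_of_charDet_ne_zero hz)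
  · intro h
    exact eigenvalues_subset_spectrum _ ((mem_eigenvalues_iff_charDet z).2 h)

theorem eigenvalues_adjointOp_eq : eigenvalues adjointOp = {z | charDet z = 0} := by
  ext z
  exact mem_eigenvalues_iff_charDet z

/-- The system depends affinely on z and the operator exponential is analytic. -/
theorem differentiable_charDet : Differentiable ℂ charDet := by
  have h1 : ∀ z, sysOp z = sysOp 0 + z • (sysOp 1 - sysOp 0) := by
    intro z
    ext y i
    fin_cases i <;> simp [sysOp_apply] <;> ring
  have h2 : Differentiable ℂ sysOp := by
    rw [funext h1]
    fun_prop
  have h3 : Differentiable ℂ fun z => flow (sysOp z) 1 := by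
    intro z
    simp only [flow, Complex.ofReal_one, one_smul]
    exact (NormedSpace.exp_analytic (𝕂 := ℂ) (sysOp z)).differentiableAt.comp z (h2 z)
  have h4 : ∀ v : Fin 4 → ℂ, ∀ i, Differentiable ℂ fun z => flow (sysOp z) 1 v i := fun v i =>
    differentiable_pi.1 (h3.clm_apply (differentiable_const v)) i
  have h5 : charDet = fun z => flow (sysOp z) 1 ![1, 0, 0, 0] 1 * flow (sysOp z) 1 ![0, 0, 1, 0] 3
      - flow (sysOp z) 1 ![0, 0, 1, 0] 1 * flow (sysOp z) 1 ![1, 0, 0, 0] 3 := by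
    funext z
    simp [charDet, bdryMatrix, Matrix.det_fin_two]
  rw [h5]
  exact ((h4 _ _).mul (h4 _ _)).sub ((h4 _ _).mul (h4 _ _))

/-- If the characteristic function is not identically zero, it has finitely many zeros in each
disc. -/
theorem finite_zeros_charDet (h : ∃ z, charDet z ≠ 0) (R : ℝ) :
    {z | charDet z = 0 ∧ ‖z‖ ≤ R}.Finite := by
  have hA : AnalyticOnNhd ℂ charDet univ :=
    differentiable_charDet.differentiableOn.analyticOnNhd isOpen_univ
  by_contra hinf
  obtain ⟨w, -, hw⟩ := Set.Infinite.exists_accPt_of_subset_isCompact hinf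
    (isCompact_closedBall (0 : ℂ) R) (fun z hz => by simpa using hz.2)
  have hfr : ∃ᶠ z in 𝓝[≠] w, charDet z = 0 :=
    (accPt_iff_frequently_nhdsNE.1 hw).mono fun z hz => hz.1
  have := hA.eqOn_zero_of_preconnected_of_frequently_eq_zero isPreconnected_univ (mem_univ w) hfr
  obtain ⟨z, hz⟩ := h
  exact hz (this (mem_univ z))

/-! ### The characteristic equation in terms of the exponents -/

/-- The eigenvector of `sysOp z` with second entry `1`, for a characteristic root `m`. -/
def rootVector (z m : ℂ) : Fin 4 → ℂ := ![1 - m ^ 2 / z, 1, m, (2 - m ^ 2 / z) / z]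

theorem sysOp_rootVector {z m : ℂ} (hz : z ≠ 0) (hm : m ^ 3 - z * m ^ 2 - 2 * z * m + z ^ 2 = 0) :
    sysOp z (rootVector z m) = m • rootVector z m := by
  rw [sysOp_apply]
  ext i
  fin_cases i
  · simp [rootVector]
    field_simp
    linear_combination hm
  · simp [rootVector]
  · simp [rootVector]
    field_simp
    ring
  · simp [rootVector]
    field_simp
    linear_combination hm

theorem flow_rootVector {z m : ℂ} (hz : z ≠ 0) (hm : m ^ 3 - z * m ^ 2 - 2 * z * m + z ^ 2 = 0) :
    flow (sysOp z) 1 (rootVector z m) = Complex.exp m • rootVector z m := by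
  simpa using flow_apply_eigenvector _ (sysOp_rootVector hz hm) 1

theorem flow_last (z : ℂ) : flow (sysOp z) 1 ![0, 0, 0, 1] = ![0, 0, 0, 1] := by
  have h : sysOp z ![0, 0, 0, 1] = (0 : ℂ) • ![0, 0, 0, 1] := by
    rw [sysOp_apply]
    ext i
    fin_cases i <;> simp
  simpa using flow_apply_eigenvector _ h 1

section

variable {z m₁ m₂ m₃ : ℂ} (hz : z ≠ 0)
  (h₁ : m₁ ^ 3 - z * m₁ ^ 2 - 2 * z * m₁ + z ^ 2 = 0)
  (h₂ : m₂ ^ 3 - z * m₂ ^ 2 - 2 * z * m₂ + z ^ 2 = 0)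
  (h₃ : m₃ ^ 3 - z * m₃ ^ 2 - 2 * z * m₃ + z ^ 2 = 0)

include hz h₁ h₂ h₃

/-- The initial data are expanded in the three root vectors and the kernel vector (0,0,0,1), on
which the flow acts by scalars. The condition on the sum of the coefficients encodes η(0) = 0. -/
theorem flow_initialData_of_roots {a₁ a₂ a₃ : ℂ} (ha : a₁ + a₂ + a₃ = 0) {c : Fin 2 → ℂ}
    (hc1 : c 1 = a₁ * m₁ + a₂ * m₂ + a₃ * m₃)
    (hc0 : -z * c 0 = a₁ * m₁ ^ 2 + a₂ * m₂ ^ 2 + a₃ * m₃ ^ 2) :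
    (flow (sysOp z) 1 (initialData c) 1 = 0 ∧ flow (sysOp z) 1 (initialData c) 3 = 0) ↔
      (a₁ * Complex.exp m₁ + a₂ * Complex.exp m₂ + a₃ * Complex.exp m₃ = 0 ∧
        a₁ * (m₁ ^ 2 * (Complex.exp m₁ - 1)) + a₂ * (m₂ ^ 2 * (Complex.exp m₂ - 1)) +
          a₃ * (m₃ ^ 2 * (Complex.exp m₃ - 1)) = 0) := by
  have hini : initialData c = a₁ • rootVector z m₁ + a₂ • rootVector z m₂ + a₃ • rootVector z m₃ +
      (-c 0 / z) • ![0, 0, 0, 1] := by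
    ext i
    fin_cases i
    · simp [initialData_apply, rootVector]
      field_simp
      linear_combination -hc0 - z * ha
    · simp [initialData_apply, rootVector]
      exact ha.symm
    · simp [initialData_apply, rootVector]
      exact hc1
    · simp [initialData_apply, rootVector]
      field_simp
      linear_combination -hc0 - 2 * z * ha
  have hflow : flow (sysOp z) 1 (initialData c) = (a₁ * Complex.exp m₁) • rootVector z m₁ +
      (a₂ * Complex.exp m₂) • rootVector z m₂ + (a₃ * Complex.exp m₃) • rootVector z m₃ +
      (-c 0 / z) • ![0, 0, 0, 1] := by
    rw [hini]
    simp only [map_add, map_smul, flow_rootVector hz h₁, flow_rootVector hz h₂,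
      flow_rootVector hz h₃, flow_last, smul_smul]
  have e1 : flow (sysOp z) 1 (initialData c) 1 =
      a₁ * Complex.exp m₁ + a₂ * Complex.exp m₂ + a₃ * Complex.exp m₃ := by
    rw [hflow]
    simp [rootVector]
  have e3 : z ^ 2 * flow (sysOp z) 1 (initialData c) 3 =
      2 * z * (a₁ * Complex.exp m₁ + a₂ * Complex.exp m₂ + a₃ * Complex.exp m₃) -
      (a₁ * (m₁ ^ 2 * (Complex.exp m₁ - 1)) + a₂ * (m₂ ^ 2 * (Complex.exp m₂ - 1)) +
          a₃ * (m₃ ^ 2 * (Complex.exp m₃ - 1))) := by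
    rw [hflow]
    simp [rootVector]
    field_simp
    linear_combination hc0
  rw [e1]
  refine and_congr_right fun h => ?_
  rw [h, mul_zero, zero_sub] at e3
  constructor
  · intro h3
    rw [h3, mul_zero] at e3
    exact neg_eq_zero.1 e3.symm
  · intro h3
    rw [h3, neg_zero] at e3
    exact (mul_eq_zero.1 e3).resolve_left (pow_ne_zero 2 hz)

/-- For distinct roots the Vandermonde matrix `U` translates between the initial data and the
coefficients of the expansion. A nonzero admissible coefficient vector exists exactly when the 3×3
matrix `N` is singular. -/
theorem charDet_eq_zero_iff_of_roots (h12 : m₁ ≠ m₂) (h13 : m₁ ≠ m₃) (h23 : m₂ ≠ m₃) :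
    charDet z = 0 ↔
      m₁ ^ 2 * (Complex.exp m₁ - 1) * (Complex.exp m₃ - Complex.exp m₂) +
      m₂ ^ 2 * (Complex.exp m₂ - 1) * (Complex.exp m₁ - Complex.exp m₃) +
      m₃ ^ 2 * (Complex.exp m₃ - 1) * (Complex.exp m₂ - Complex.exp m₁) = 0 := by
  set N : Matrix (Fin 3) (Fin 3) ℂ := !![1, 1, 1; Complex.exp m₁, Complex.exp m₂, Complex.exp m₃;
    m₁ ^ 2 * (Complex.exp m₁ - 1), m₂ ^ 2 * (Complex.exp m₂ - 1), m₃ ^ 2 * (Complex.exp m₃ - 1)]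
    with hN
  have hdet : m₁ ^ 2 * (Complex.exp m₁ - 1) * (Complex.exp m₃ - Complex.exp m₂) +
      m₂ ^ 2 * (Complex.exp m₂ - 1) * (Complex.exp m₁ - Complex.exp m₃) +
      m₃ ^ 2 * (Complex.exp m₃ - 1) * (Complex.exp m₂ - Complex.exp m₁) = N.det := by
    simp [hN, Matrix.det_fin_three]
    ring
  set U : Matrix (Fin 3) (Fin 3) ℂ := !![1, 1, 1; m₁, m₂, m₃; m₁ ^ 2, m₂ ^ 2, m₃ ^ 2] with hU
  have hUdet : U.det ≠ 0 := by
    have : U.det = (m₂ - m₁) * (m₃ - m₁) * (m₃ - m₂) := by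
      simp [hU, Matrix.det_fin_three]
      ring
    rw [this]
    exact mul_ne_zero (mul_ne_zero (sub_ne_zero.2 h12.symm) (sub_ne_zero.2 h13.symm))
      (sub_ne_zero.2 h23.symm)
  rw [hdet, ← Matrix.exists_mulVec_eq_zero_iff, charDet_eq_zero_iff]
  have hNa : ∀ a : Fin 3 → ℂ, N.mulVec a = 0 ↔ a 0 + a 1 + a 2 = 0 ∧
      (a 0 * Complex.exp m₁ + a 1 * Complex.exp m₂ + a 2 * Complex.exp m₃ = 0 ∧
        a 0 * (m₁ ^ 2 * (Complex.exp m₁ - 1)) + a 1 * (m₂ ^ 2 * (Complex.exp m₂ - 1)) +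
          a 2 * (m₃ ^ 2 * (Complex.exp m₃ - 1)) = 0) := by
    intro a
    rw [funext_iff, Fin.forall_fin_succ, Fin.forall_fin_two]
    simp [hN, Matrix.mulVec, dotProduct, Fin.sum_univ_three, mul_comm]
  have hUa : ∀ a : Fin 3 → ℂ, U.mulVec a = ![a 0 + a 1 + a 2, a 0 * m₁ + a 1 * m₂ + a 2 * m₃,
      a 0 * m₁ ^ 2 + a 1 * m₂ ^ 2 + a 2 * m₃ ^ 2] := by
    intro a
    ext i
    fin_cases i <;> simp [hU, Matrix.mulVec, dotProduct, Fin.sum_univ_three, mul_comm]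
  constructor
  · rintro ⟨c, hc, h⟩
    set a : Fin 3 → ℂ := U⁻¹.mulVec ![0, c 1, -z * c 0] with ha
    have h1 : U.mulVec a = ![0, c 1, -z * c 0] := by
      rw [ha, Matrix.mulVec_mulVec, Matrix.mul_nonsing_inv _ (isUnit_iff_ne_zero.2 hUdet),
        Matrix.one_mulVec]
    rw [hUa] at h1
    have k0 : a 0 + a 1 + a 2 = 0 := by simpa using congrFun h1 0
    have k1 : a 0 * m₁ + a 1 * m₂ + a 2 * m₃ = c 1 := by simpa using congrFun h1 1
    have k2 : a 0 * m₁ ^ 2 + a 1 * m₂ ^ 2 + a 2 * m₃ ^ 2 = -z * c 0 := by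
      simpa using congrFun h1 2
    refine ⟨a, fun h0 => hc ?_, (hNa a).2 ⟨k0, ?_⟩⟩
    · simp only [h0, Pi.zero_apply, zero_mul, add_zero] at k1 k2
      ext i
      fin_cases i
      · simpa [hz] using k2.symm
      · simpa using k1.symm
    · exact (flow_initialData_of_roots hz h₁ h₂ h₃ k0 k1.symm k2.symm).1 h
  · rintro ⟨a, ha, h⟩
    obtain ⟨k0, h⟩ := (hNa a).1 h
    set c : Fin 2 → ℂ := ![-(a 0 * m₁ ^ 2 + a 1 * m₂ ^ 2 + a 2 * m₃ ^ 2) / z,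
      a 0 * m₁ + a 1 * m₂ + a 2 * m₃] with hc
    have k1 : c 1 = a 0 * m₁ + a 1 * m₂ + a 2 * m₃ := by simp [hc]
    have k2 : -z * c 0 = a 0 * m₁ ^ 2 + a 1 * m₂ ^ 2 + a 2 * m₃ ^ 2 := by
      simp [hc]
      field_simp
      ring
    refine ⟨c, fun h0 => ha ?_, (flow_initialData_of_roots hz h₁ h₂ h₃ k0 k1 k2).2 h⟩
    by_contra hne
    apply hUdet
    rw [← Matrix.exists_mulVec_eq_zero_iff]
    refine ⟨a, hne, ?_⟩
    rw [hUa, k0, ← k1, ← k2, h0]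
    ext i
    fin_cases i <;> simp

end

/-! ### Rational parametrization of the cubic and asymptotics of its roots -/

/-- A rational parametrization of the large eigenvalue parameters. -/
def param (v : ℂ) : ℂ := -1 + v - v⁻¹ + v⁻¹ ^ 2

/-- The characteristic root of `param v` close to `param v`. -/
def bigRoot (v : ℂ) : ℂ := v - v⁻¹

/-- Half the sum of the two remaining characteristic roots of `param v`. -/
def midRoot (v : ℂ) : ℂ := (v⁻¹ ^ 2 - 1) / 2

/-- The square of half the difference of the two remaining characteristic roots of `param v`. -/
def sqDiff (v : ℂ) : ℂ := midRoot v ^ 2 + v - 2 + 2 * v⁻¹ ^ 2 - v⁻¹ ^ 3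

/-- The cubic is quadratic in z with discriminant m²(m² + 4). Setting m = v - 1/v makes this the
square of m(v + 1/v), and the branch with z close to v is `param v`. -/
theorem char_poly_factor {v : ℂ} (hv : v ≠ 0) (m : ℂ) :
    m ^ 3 - param v * m ^ 2 - 2 * param v * m + param v ^ 2 =
      (m - bigRoot v) * ((m - midRoot v) ^ 2 - sqDiff v) := by
  simp only [param, bigRoot, midRoot, sqDiff]
  field_simp
  ring

/-- The perturbation in the characteristic equation `(exp m₁ - 1) (1 - exp (-2 w)) = W`. -/
def charRem (v w : ℂ) : ℂ :=
  ((midRoot v + w) ^ 2 * (Complex.exp (midRoot v + w) - 1) *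
      (Complex.exp (bigRoot v) - Complex.exp (midRoot v - w)) +
    (midRoot v - w) ^ 2 * (Complex.exp (midRoot v - w) - 1) *
      (Complex.exp (midRoot v + w) - Complex.exp (bigRoot v))) /
    (bigRoot v ^ 2 * Complex.exp (midRoot v + w))

section bounds

variable {v : ℂ} (hv : 100 ≤ ‖v‖)
include hv

theorem norm_inv_le_of_le : ‖v⁻¹‖ ≤ 1 / 100 := by
  rw [norm_inv, one_div]
  exact inv_anti₀ (by norm_num) hv

theorem norm_bigRoot_sub_le : ‖bigRoot v - v‖ ≤ 1 / 100 := by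
  have := norm_inv_le_of_le hv
  simpa [bigRoot] using this

theorem norm_midRoot_add_le : ‖midRoot v + 1 / 2‖ ≤ 1 / 100 := by
  have h := norm_inv_le_of_le hv
  have e : midRoot v + 1 / 2 = v⁻¹ ^ 2 / 2 := by simp only [midRoot]; ring
  rw [e, norm_div, norm_pow]
  simp only [Complex.norm_ofNat]
  nlinarith [norm_nonneg v⁻¹]

theorem norm_sqDiff_sub_le : ‖sqDiff v - v‖ ≤ 2 := by
  have h := norm_inv_le_of_le hv
  have e : sqDiff v - v = -(7 / 4) + (3 / 2 * v⁻¹ ^ 2 - v⁻¹ ^ 3 + v⁻¹ ^ 4 / 4) := by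
    simp only [sqDiff, midRoot]; ring
  rw [e]
  have h0 := norm_nonneg v⁻¹
  have h2 : ‖v⁻¹‖ ^ 2 ≤ (1 / 100) ^ 2 := by gcongr
  have h3 : ‖v⁻¹‖ ^ 3 ≤ (1 / 100) ^ 3 := by gcongr
  have h4 : ‖v⁻¹‖ ^ 4 ≤ (1 / 100) ^ 4 := by gcongr
  have n1 := norm_add_le (-(7 / 4)) (3 / 2 * v⁻¹ ^ 2 - v⁻¹ ^ 3 + v⁻¹ ^ 4 / 4)
  have n2 := norm_add_le (3 / 2 * v⁻¹ ^ 2 - v⁻¹ ^ 3) (v⁻¹ ^ 4 / 4)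
  have n3 := norm_sub_le (3 / 2 * v⁻¹ ^ 2) (v⁻¹ ^ 3)
  simp only [norm_neg, norm_div, norm_mul, norm_pow, Complex.norm_ofNat] at n1 n2 n3
  linarith

theorem ne_zero_of_le_norm : v ≠ 0 := by
  rintro rfl
  norm_num at hv

variable {w : ℂ} (hw : w ^ 2 = sqDiff v)
include hw

theorem sq_norm_le_of_sq_eq : ‖w‖ ^ 2 ≤ ‖v‖ + 2 := by
  rw [← norm_pow, hw]
  have := norm_sqDiff_sub_le hv
  have h2 := norm_add_le v (sqDiff v - v)
  rw [add_sub_cancel] at h2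
  linarith

theorem le_sq_norm_of_sq_eq : ‖v‖ - 2 ≤ ‖w‖ ^ 2 := by
  rw [← norm_pow, hw]
  have := norm_sqDiff_sub_le hv
  have h2 := norm_sub_norm_le v (sqDiff v)
  rw [norm_sub_rev] at h2
  linarith

/-- With m₂ and m₃ equal to `midRoot v` ± w, one has exp m₃ = exp m₂ · exp(-2w). Dividing the
determinant by m₁² exp m₂ isolates the term carrying m₁², which dominates because m₁ has size |v|
and the other roots have size √|v|. -/
theorem charDet_param_eq_zero_iff :
    charDet (param v) = 0 ↔
      (Complex.exp (bigRoot v) - 1) * (1 - Complex.exp (-(2 * w))) = charRem v w := by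
  have hv0 := ne_zero_of_le_norm hv
  have hw1 := sq_norm_le_of_sq_eq hv hw
  have hw2 := le_sq_norm_of_sq_eq hv hw
  have hb := norm_bigRoot_sub_le hv
  have hm := norm_midRoot_add_le hv
  have hroot : ∀ m, (m - bigRoot v) * ((m - midRoot v) ^ 2 - sqDiff v) = 0 →
      m ^ 3 - param v * m ^ 2 - 2 * param v * m + param v ^ 2 = 0 := fun m h => by
    rw [char_poly_factor hv0, h]
  have hbig : ‖v‖ - 1 / 100 ≤ ‖bigRoot v‖ := by
    have := norm_sub_norm_le v (bigRoot v)
    rw [norm_sub_rev] at this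
    linarith
  have hmid : ‖midRoot v‖ ≤ 51 / 100 := by
    have := norm_sub_le (midRoot v + 1 / 2) (1 / 2)
    rw [add_sub_cancel_right] at this
    norm_num at this
    linarith
  have hw0 : w ≠ 0 := by
    rintro rfl
    norm_num at hw2
    linarith
  have hb0 : bigRoot v ≠ 0 := by
    intro h
    rw [h, norm_zero] at hbig
    linarith
  -- Roots of size |v| and √|v| cannot coincide when |v| ≥ 100.
  have hsmall : ∀ t : ℂ, ‖t‖ = ‖w‖ → bigRoot v ≠ midRoot v + t := by
    intro t ht h
    rw [h] at hbig
    have := norm_add_le (midRoot v) t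
    rw [ht] at this
    nlinarith
  have hz : param v ≠ 0 := by
    intro h
    have e : bigRoot v = 1 - v⁻¹ ^ 2 := by
      simp only [param, bigRoot] at h ⊢
      linear_combination h
    rw [e] at hbig
    have h1 := norm_sub_le (1 : ℂ) (v⁻¹ ^ 2)
    rw [norm_pow, norm_one] at h1
    nlinarith [norm_inv_le_of_le hv, norm_nonneg v⁻¹]
  rw [charDet_eq_zero_iff_of_roots (m₁ := bigRoot v) (m₂ := midRoot v + w) (m₃ := midRoot v - w) hz
    (hroot _ (by ring)) (hroot _ (by rw [← hw]; ring)) (hroot _ (by rw [← hw]; ring))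
    (hsmall w rfl) (by rw [sub_eq_add_neg]; exact hsmall _ (norm_neg _))
    (fun h => hw0 (by linear_combination h / 2))]
  have hq : Complex.exp (midRoot v - w) =
      Complex.exp (midRoot v + w) * Complex.exp (-(2 * w)) := by
    rw [← Complex.exp_add]; congr 1; ring
  have he := Complex.exp_ne_zero (midRoot v + w)
  rw [charRem, eq_div_iff (mul_ne_zero (pow_ne_zero 2 hb0) he)]
  constructor
  · intro h
    linear_combination -h + (Complex.exp (bigRoot v) - 1) * bigRoot v ^ 2 * hq
  · intro h
    linear_combination -h + (Complex.exp (bigRoot v) - 1) * bigRoot v ^ 2 * hq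

/-- The numerator carries squares of the two smaller roots, of size at most 2|v|, against m₁² of
size about |v|². The lower bound on Re w keeps the exponentials under control. It is -1 and not 0
because the parabolic branch uses a w near the imaginary axis. -/
theorem norm_charRem_le (hre : -1 ≤ w.re) :
    ‖charRem v w‖ ≤ 80 * max 1 ‖Complex.exp (bigRoot v)‖ / ‖v‖ := by
  set M := max 1 ‖Complex.exp (bigRoot v)‖ with hM
  have hM1 : 1 ≤ M := le_max_left _ _
  have hMe : ‖Complex.exp (bigRoot v)‖ ≤ M := le_max_right _ _
  have hw1 := sq_norm_le_of_sq_eq hv hw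
  have hb := norm_bigRoot_sub_le hv
  have hm := norm_midRoot_add_le hv
  have hbig : ‖v‖ - 1 / 100 ≤ ‖bigRoot v‖ := by
    have := norm_sub_norm_le v (bigRoot v)
    rw [norm_sub_rev] at this
    linarith
  have hmid : ‖midRoot v‖ ≤ 51 / 100 := by
    have := norm_sub_le (midRoot v + 1 / 2) (1 / 2)
    rw [add_sub_cancel_right] at this
    norm_num at this
    linarith
  have hmre : |(midRoot v).re + 1 / 2| ≤ 1 / 100 := by
    have := (Complex.abs_re_le_norm (midRoot v + 1 / 2)).trans hm
    simpa using this
  obtain ⟨hr1, hr2⟩ := abs_le.1 hmre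
  have hsq : ∀ t : ℂ, ‖t‖ = ‖w‖ → ‖(midRoot v + t) ^ 2‖ ≤ 2 * ‖v‖ := by
    intro t ht
    have := norm_add_le (midRoot v) t
    rw [ht] at this
    rw [norm_pow]
    have h2 : ‖midRoot v + t‖ ^ 2 ≤ (51 / 100 + ‖w‖) ^ 2 := by gcongr; linarith
    nlinarith [sq_nonneg (‖w‖ - 10)]
  have he3 : ‖Complex.exp (midRoot v - w)‖ ≤ 2 := by
    rw [Complex.norm_exp, Complex.sub_re]
    calc Real.exp ((midRoot v).re - w.re) ≤ Real.exp (0.69) :=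
          Real.exp_le_exp.2 (by norm_num; linarith)
      _ ≤ Real.exp (Real.log 2) := Real.exp_le_exp.2 (by linarith [Real.log_two_gt_d9])
      _ = 2 := Real.exp_log (by norm_num)
  set e₂ := Complex.exp (midRoot v + w) with he₂
  have he20 : e₂ ≠ 0 := Complex.exp_ne_zero _
  have he2 : ‖e₂⁻¹‖ ≤ 5 := by
    rw [he₂, ← Complex.exp_neg, Complex.norm_exp]
    have h1 : (-(midRoot v + w)).re ≤ 3 / 2 + 1 / 100 := by
      simp only [Complex.neg_re, Complex.add_re]
      linarith
    have h3 : Real.exp (3 / 2 + 1 / 100) ≤ Real.exp (Real.log 5) := by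
      apply Real.exp_le_exp.2
      have h4 : (4 : ℝ) * (3 / 2 + 1 / 100) ≤ 9 * Real.log 2 := by
        linarith [Real.log_two_gt_d9]
      have h5 : 9 * Real.log 2 ≤ 4 * Real.log 5 := by
        rw [← Real.log_rpow (by norm_num), ← Real.log_rpow (by norm_num)]
        apply Real.log_le_log (by positivity)
        norm_num
      linarith
    rw [Real.exp_log (by norm_num)] at h3
    exact (Real.exp_le_exp.2 h1).trans h3
  have hb0 : bigRoot v ≠ 0 := by
    intro h
    rw [h, norm_zero] at hbig
    linarith
  -- Cancelling exp m₂ leaves only its inverse and exp m₃, which stay bounded even when Re w is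
  -- large.
  have e : charRem v w = ((midRoot v + w) ^ 2 * ((1 - e₂⁻¹) *
      (Complex.exp (bigRoot v) - Complex.exp (midRoot v - w))) +
    (midRoot v + -w) ^ 2 * ((Complex.exp (midRoot v - w) - 1) *
      (1 - Complex.exp (bigRoot v) * e₂⁻¹))) / bigRoot v ^ 2 := by
    rw [charRem, ← he₂]
    field_simp
    ring
  have n1 : ‖1 - e₂⁻¹‖ ≤ 6 := (norm_sub_le _ _).trans (by rw [norm_one]; linarith)
  have n2 : ‖Complex.exp (bigRoot v) - Complex.exp (midRoot v - w)‖ ≤ 3 * M :=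
    (norm_sub_le _ _).trans (by linarith)
  have n3 : ‖Complex.exp (midRoot v - w) - 1‖ ≤ 3 :=
    (norm_sub_le _ _).trans (by rw [norm_one]; linarith)
  have n4 : ‖1 - Complex.exp (bigRoot v) * e₂⁻¹‖ ≤ 6 * M := by
    refine (norm_sub_le _ _).trans ?_
    rw [norm_one, norm_mul]
    have : ‖Complex.exp (bigRoot v)‖ * ‖e₂⁻¹‖ ≤ M * 5 := by gcongr
    linarith
  have hnum : ‖(midRoot v + w) ^ 2 * ((1 - e₂⁻¹) *
      (Complex.exp (bigRoot v) - Complex.exp (midRoot v - w))) +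
    (midRoot v + -w) ^ 2 * ((Complex.exp (midRoot v - w) - 1) *
      (1 - Complex.exp (bigRoot v) * e₂⁻¹))‖ ≤
      2 * ‖v‖ * (6 * (3 * M)) + 2 * ‖v‖ * (3 * (6 * M)) := by
    refine (norm_add_le _ _).trans ?_
    rw [norm_mul _ ((1 - e₂⁻¹) * _), norm_mul (1 - e₂⁻¹), norm_mul _ ((_ - 1) * _),
      norm_mul (_ - 1) _]
    gcongr
    · exact hsq w rfl
    · exact hsq (-w) (norm_neg w)
  rw [e, norm_div, norm_pow]
  have hd : 9 / 10 * ‖v‖ ^ 2 ≤ ‖bigRoot v‖ ^ 2 := by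
    have : 99 / 100 * ‖v‖ ≤ ‖bigRoot v‖ := by linarith
    nlinarith
  have hv0 : 0 < ‖v‖ := by linarith
  rw [div_le_div_iff₀ (by positivity) hv0]
  calc _ ≤ (2 * ‖v‖ * (6 * (3 * M)) + 2 * ‖v‖ * (3 * (6 * M))) * ‖v‖ := by gcongr
    _ = 80 * M * (9 / 10 * ‖v‖ ^ 2) := by ring
    _ ≤ _ := by gcongr

end bounds

/-! ### Branches of the square root and logarithm -/

/-- The square root with non-negative real part. -/
def csqrt (s : ℂ) : ℂ := Complex.exp (Complex.log s / 2)

theorem csqrt_sq {s : ℂ} (hs : s ≠ 0) : csqrt s ^ 2 = s := by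
  rw [csqrt, ← Complex.exp_nat_mul]
  push_cast
  rw [mul_div_cancel₀ _ (two_ne_zero), Complex.exp_log hs]

theorem csqrt_re_nonneg (s : ℂ) : 0 ≤ (csqrt s).re := by
  rw [csqrt, Complex.exp_re]
  have h : (Complex.log s / 2).im = s.arg / 2 := by
    rw [← Complex.log_im]; simp
  rw [h]
  have h1 := Complex.neg_pi_lt_arg s
  have h2 := Complex.arg_le_pi s
  exact mul_nonneg (Real.exp_pos _).le (Real.cos_nonneg_of_mem_Icc ⟨by linarith, by linarith⟩)

theorem differentiableAt_csqrt {s : ℂ} (hs : s ∈ Complex.slitPlane) :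
    DifferentiableAt ℂ csqrt s :=
  ((Complex.differentiableAt_log hs).div_const 2).cexp

theorem norm_log_one_add_le_of_le {ε : ℂ} {b : ℝ} (h : ‖ε‖ ≤ b) (hb : b ≤ 1 / 2) :
    ‖Complex.log (1 + ε)‖ ≤ 3 / 2 * b :=
  (Complex.norm_log_one_add_half_le_self (h.trans hb)).trans (by gcongr)

theorem one_add_mem_slitPlane {ε : ℂ} (h : ‖ε‖ ≤ 1 / 2) : 1 + ε ∈ Complex.slitPlane := by
  left
  have := (abs_le.1 (Complex.abs_re_le_norm ε)).1
  simp only [Complex.add_re, Complex.one_re]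
  linarith

/-- The logarithm solves `exp x = 1 + ε` among the `x` in a strip of width `2 π`. -/
theorem exp_eq_one_add_iff {x ε : ℂ} (k : ℤ) (hx : ‖x - 2 * Real.pi * Complex.I * k‖ ≤ 2)
    (hε : ‖ε‖ ≤ 1 / 2) :
    Complex.exp x = 1 + ε ↔ x = 2 * Real.pi * Complex.I * k + Complex.log (1 + ε) := by
  have hper : Complex.exp (2 * Real.pi * Complex.I * k) = 1 := by
    rw [mul_comm]; exact Complex.exp_int_mul_two_pi_mul_I k
  constructor
  · intro h
    have h1 : Complex.exp (x - 2 * Real.pi * Complex.I * k) = 1 + ε := by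
      rw [Complex.exp_sub, hper, h, div_one]
    have him := abs_le.1 ((Complex.abs_im_le_norm _).trans hx)
    rw [← h1, Complex.log_exp (by linarith [Real.pi_gt_three, him.1])
      (by linarith [Real.pi_gt_three, him.2])]
    ring
  · intro h
    rw [h, Complex.exp_add, hper, one_mul,
      Complex.exp_log (Complex.slitPlane_ne_zero (one_add_mem_slitPlane hε))]

theorem exists_int_near_of_exp_near {x : ℂ} {b : ℝ} (h : ‖Complex.exp x - 1‖ ≤ b)
    (hb : b ≤ 1 / 2) : ∃ k : ℤ, ‖x - 2 * Real.pi * Complex.I * k‖ ≤ 3 / 2 * b := by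
  have h1 := norm_log_one_add_le_of_le h hb
  rw [add_sub_cancel] at h1
  obtain ⟨n, hn⟩ := Complex.exp_eq_exp_iff_exists_int.1 (Complex.exp_log (Complex.exp_ne_zero x))
  refine ⟨-n, ?_⟩
  rw [hn] at h1
  convert h1 using 2
  push_cast
  ring

theorem differentiableAt_midRoot {v : ℂ} (hv : v ≠ 0) : DifferentiableAt ℂ midRoot v := by
  unfold midRoot
  fun_prop (disch := assumption)

theorem differentiableAt_bigRoot {v : ℂ} (hv : v ≠ 0) : DifferentiableAt ℂ bigRoot v := by
  unfold bigRoot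
  fun_prop (disch := assumption)

theorem differentiableAt_sqDiff {v : ℂ} (hv : v ≠ 0) : DifferentiableAt ℂ sqDiff v := by
  have := differentiableAt_midRoot hv
  unfold sqDiff
  fun_prop (disch := assumption)

theorem bigRoot_ne_zero {v : ℂ} (hv : 100 ≤ ‖v‖) : bigRoot v ≠ 0 := by
  intro h
  have := norm_bigRoot_sub_le hv
  rw [h, zero_sub, norm_neg] at this
  linarith

theorem differentiableAt_charRem {v : ℂ} {w : ℂ → ℂ} (hv : 100 ≤ ‖v‖)
    (hw : DifferentiableAt ℂ w v) : DifferentiableAt ℂ (fun v => charRem v (w v)) v := by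
  have hv0 := ne_zero_of_le_norm hv
  have h1 := differentiableAt_midRoot hv0
  have h2 := differentiableAt_bigRoot hv0
  have h3 : bigRoot v ^ 2 * Complex.exp (midRoot v + w v) ≠ 0 :=
    mul_ne_zero (pow_ne_zero 2 (bigRoot_ne_zero hv)) (Complex.exp_ne_zero _)
  unfold charRem
  fun_prop (disch := assumption)

theorem exp_bigRoot_norm {v : ℂ} (hv : 100 ≤ ‖v‖) :
    ‖Complex.exp (bigRoot v)‖ ≤ Real.exp (v.re + 1 / 100) := by
  rw [Complex.norm_exp]
  apply Real.exp_le_exp.2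
  have := (abs_le.1 ((Complex.abs_re_le_norm _).trans (norm_bigRoot_sub_le hv))).2
  rw [Complex.sub_re] at this
  linarith

theorem norm_two_pi_I_mul_int (k : ℤ) :
    ‖2 * Real.pi * Complex.I * (k : ℂ)‖ = 2 * Real.pi * |(k : ℝ)| := by
  simp [abs_of_pos Real.pi_pos]

/-! ### Zeros near the hyperbolic and parabolic points -/

/-- Existence and uniqueness of the zero of the characteristic function near `2 π i k`. -/
theorem exists_hyperbolic_zero (k : ℤ) (hk : (5000 : ℝ) ≤ |(k : ℝ)|) :
    ∃ v : ℂ, ‖v - 2 * Real.pi * Complex.I * k‖ ≤ 2401 / |(k : ℝ)| ∧ charDet (param v) = 0 ∧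
      ∀ u : ℂ, ‖u - 2 * Real.pi * Complex.I * k‖ ≤ 1 → charDet (param u) = 0 → u = v := by
  set a : ℂ := 2 * Real.pi * Complex.I * k with ha
  set n : ℝ := |(k : ℝ)| with hn
  have hn0 : 0 < n := by linarith
  have hpi3 := Real.pi_gt_three
  have hna : ‖a‖ = 2 * Real.pi * n := norm_two_pi_I_mul_int k
  set w : ℂ → ℂ := fun v => csqrt (sqDiff v) with hw
  have hball : ∀ v ∈ Metric.ball a (3 * 1), ‖v - a‖ < 3 := fun v hv => by
    simpa [dist_eq_norm] using hv
  have hnorm : ∀ v ∈ Metric.ball a (3 * 1), 3 * n ≤ ‖v‖ := by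
    intro v hv
    have h1 := hball v hv
    have h2 := norm_sub_norm_le a v
    rw [norm_sub_rev, hna] at h2
    nlinarith
  have h100 : ∀ v ∈ Metric.ball a (3 * 1), 100 ≤ ‖v‖ := fun v hv => by linarith [hnorm v hv]
  have hsq : ∀ v ∈ Metric.ball a (3 * 1), ‖sqDiff v - a‖ ≤ 5 := by
    intro v hv
    have h1 := hball v hv
    have h2 := norm_sqDiff_sub_le (h100 v hv)
    have h3 := norm_add_le (sqDiff v - v) (v - a)
    rw [sub_add_sub_cancel] at h3
    linarith
  have hre : ∀ v ∈ Metric.ball a (3 * 1), |v.re| ≤ 3 := by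
    intro v hv
    have h1 := (Complex.abs_re_le_norm (v - a)).trans (hball v hv).le
    simpa [ha] using h1
  have hslit : ∀ v ∈ Metric.ball a (3 * 1), sqDiff v ∈ Complex.slitPlane := by
    intro v hv
    right
    intro h
    have h1 := (Complex.abs_im_le_norm (sqDiff v - a)).trans (hsq v hv)
    rw [Complex.sub_im, h, zero_sub, abs_neg] at h1
    have h2 : a.im = 2 * Real.pi * k := by simp [ha]
    rw [h2, abs_mul, abs_of_pos (by positivity)] at h1
    nlinarith
  have hwsq : ∀ v ∈ Metric.ball a (3 * 1), w v ^ 2 = sqDiff v := fun v hv =>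
    csqrt_sq (Complex.slitPlane_ne_zero (hslit v hv))
  have hw0 : ∀ v, 0 ≤ (w v).re := fun v => csqrt_re_nonneg _
  -- Here 2(Re w)² = |w|² + Re w², where |w|² is about |v| and Re w² ≥ -5.
  have hwre : ∀ v ∈ Metric.ball a (3 * 1), 1 ≤ (w v).re := by
    intro v hv
    have h1 := le_sq_norm_of_sq_eq (h100 v hv) (hwsq v hv)
    have h2 := congrArg Complex.re (hwsq v hv)
    have h3 := (abs_le.1 ((Complex.abs_re_le_norm (sqDiff v - a)).trans (hsq v hv))).1
    have h4 : a.re = 0 := by simp [ha]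
    rw [Complex.sub_re, h4, sub_zero] at h3
    rw [← h2, pow_two, Complex.mul_re] at h3
    rw [Complex.sq_norm, Complex.normSq_apply] at h1
    nlinarith [hnorm v hv, hw0 v]
  have hq : ∀ v ∈ Metric.ball a (3 * 1), 1 / 2 ≤ ‖1 - Complex.exp (-(2 * w v))‖ := by
    intro v hv
    have h1 : ‖Complex.exp (-(2 * w v))‖ ≤ 1 / 2 := by
      rw [Complex.norm_exp]
      have h2 : (-(2 * w v)).re ≤ -Real.log 2 := by
        simp only [Complex.neg_re, Complex.mul_re, Complex.re_ofNat, Complex.im_ofNat, zero_mul,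
          sub_zero]
        linarith [hwre v hv, Real.log_two_lt_d9]
      refine (Real.exp_le_exp.2 h2).trans ?_
      rw [Real.exp_neg, Real.exp_log two_pos]
      norm_num
    have h2 := norm_sub_norm_le (1 : ℂ) (Complex.exp (-(2 * w v)))
    rw [norm_one] at h2
    linarith
  have hq0 : ∀ v ∈ Metric.ball a (3 * 1), 1 - Complex.exp (-(2 * w v)) ≠ 0 := fun v hv h => by
    have := hq v hv
    rw [h, norm_zero] at this
    norm_num at this
  set ε : ℂ → ℂ := fun v => charRem v (w v) / (1 - Complex.exp (-(2 * w v))) with hε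
  -- Since Re v ≤ 3, exp m₁ is bounded by 30. Then 80·30/(3n) = 800/n, and the denominator is at
  -- least 1/2.
  have hεb : ∀ v ∈ Metric.ball a (3 * 1), ‖ε v‖ ≤ 1600 / n := by
    intro v hv
    have h1 := norm_charRem_le (h100 v hv) (hwsq v hv) (by linarith [hw0 v])
    have h2 : max 1 ‖Complex.exp (bigRoot v)‖ ≤ 30 := by
      refine max_le (by norm_num) ((exp_bigRoot_norm (h100 v hv)).trans ?_)
      have h3 : v.re + 1 / 100 ≤ Real.log 30 := by
        have h5 : 9 * Real.log 2 ≤ 2 * Real.log 30 := by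
          rw [← Real.log_rpow (by norm_num), ← Real.log_rpow (by norm_num)]
          apply Real.log_le_log (by positivity)
          norm_num
        linarith [(abs_le.1 (hre v hv)).2, Real.log_two_gt_d9]
      refine (Real.exp_le_exp.2 h3).trans ?_
      rw [Real.exp_log (by norm_num)]
    simp only [hε]
    rw [norm_div, div_le_div_iff₀ (by linarith [hq v hv]) hn0]
    have h3 : ‖charRem v (w v)‖ * n ≤ 800 := by
      calc ‖charRem v (w v)‖ * n ≤ (80 * 30 / (3 * n)) * n := by
            gcongr
            refine h1.trans ?_
            gcongr
            exact hnorm v hv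
        _ = 800 := by field_simp; norm_num
    linarith [hq v hv]
  have hnb : 1600 / n ≤ 1 / 2 := by
    rw [div_le_div_iff₀ hn0 two_pos]; linarith
  have hdw : ∀ v ∈ Metric.ball a (3 * 1), DifferentiableAt ℂ w v := fun v hv =>
    DifferentiableAt.comp (g := csqrt) v (differentiableAt_csqrt (hslit v hv))
      (differentiableAt_sqDiff (ne_zero_of_le_norm (h100 v hv)))
  have hdε : ∀ v ∈ Metric.ball a (3 * 1), DifferentiableAt ℂ ε v := by
    intro v hv
    have h1 := hdw v hv
    exact (differentiableAt_charRem (h100 v hv) h1).div (by fun_prop) (hq0 v hv)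
  -- The equation is exp m₁ = 1 + ε with m₁ = v - 1/v within 2 of 2πik, so the principal logarithm
  -- solves it.
  have hzero : ∀ v ∈ Metric.closedBall a 1,
      (charDet (param v) = 0 ↔ v = a + (v⁻¹ + Complex.log (1 + ε v))) := by
    intro v hv
    have hvb : v ∈ Metric.ball a (3 * 1) := Metric.closedBall_subset_ball (by norm_num) hv
    have hva : ‖v - a‖ ≤ 1 := by simpa [dist_eq_norm] using hv
    rw [charDet_param_eq_zero_iff (h100 v hvb) (hwsq v hvb), ← eq_div_iff (hq0 v hvb),
      sub_eq_iff_eq_add']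
    have hx : ‖bigRoot v - 2 * Real.pi * Complex.I * k‖ ≤ 2 := by
      have h1 := norm_add_le (bigRoot v - v) (v - a)
      rw [sub_add_sub_cancel] at h1
      linarith [norm_bigRoot_sub_le (h100 v hvb)]
    rw [exp_eq_one_add_iff k hx ((hεb v hvb).trans hnb), bigRoot, sub_eq_iff_eq_add, ← ha]
    constructor <;> intro h
    · rw [add_assoc, add_comm (Complex.log _)] at h; exact h
    · rw [add_assoc, add_comm (Complex.log _)]; exact h
  have hFb : ∀ v ∈ Metric.ball a (3 * 1), ‖v⁻¹ + Complex.log (1 + ε v)‖ ≤ 2401 / n := by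
    intro v hv
    have h1 : ‖v⁻¹‖ ≤ 1 / n := by
      rw [norm_inv, one_div]
      exact inv_anti₀ hn0 (by linarith [hnorm v hv])
    have h2 := norm_log_one_add_le_of_le (hεb v hv) hnb
    refine (norm_add_le _ _).trans ((add_le_add h1 h2).trans (le_of_eq ?_))
    ring
  have hFd : DifferentiableOn ℂ (fun v => v⁻¹ + Complex.log (1 + ε v)) (Metric.ball a (3 * 1)) := by
    intro v hv
    refine DifferentiableAt.differentiableWithinAt ?_
    exact (differentiableAt_inv (ne_zero_of_le_norm (h100 v hv))).add
      (((hdε v hv).const_add 1).clog (one_add_mem_slitPlane ((hεb v hv).trans hnb)))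
  obtain ⟨v, hv, hfix, huniq⟩ := existsUnique_fixedPoint one_pos hFd hFb
    (by rw [div_le_div_iff₀ hn0 two_pos]; linarith)
  refine ⟨v, ?_, (hzero v hv).2 hfix, fun u hu hz => ?_⟩
  · have h1 := hFb v (Metric.closedBall_subset_ball (by norm_num) hv)
    rwa [← sub_eq_iff_eq_add'.2 hfix] at h1
  · have hu' : u ∈ Metric.closedBall a 1 := by simpa [dist_eq_norm] using hu
    exact huniq u hu' ((hzero u hu').1 hz)

/-- Existence and uniqueness of the zero of the characteristic function near `-π² k²`. -/
theorem exists_parabolic_zero (k : ℕ) (hk : (100 : ℝ) ≤ k) :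
    ∃ v : ℂ, ‖v - -(Real.pi * k) ^ 2‖ ≤ 4 ∧ charDet (param v) = 0 ∧
      ∀ u : ℂ, ‖u - -(Real.pi * k) ^ 2‖ ≤ 2 * k → charDet (param u) = 0 → u = v := by
  set a : ℂ := -(Real.pi * k) ^ 2 with ha
  set n : ℝ := (k : ℝ) with hn
  have hn0 : 0 < n := by linarith
  have hpi3 := Real.pi_gt_d2
  have hpi4 := Real.pi_lt_d2
  set p : ℝ := Real.pi * n with hp
  have hp1 : 3.14 * n ≤ p := by rw [hp]; gcongr
  have hp2 : p ≤ 3.15 * n := by rw [hp]; gcongr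
  have hap : a = -((p : ℂ) ^ 2) := by simp [ha, hp, hn]
  have hare : a.re = -p ^ 2 := by
    rw [hap, ← Complex.ofReal_pow, ← Complex.ofReal_neg, Complex.ofReal_re]
  have hna : ‖a‖ = p ^ 2 := by
    rw [hap, norm_neg, norm_pow, Complex.norm_real, Real.norm_eq_abs, sq_abs]
  have hpn : 9 * n ^ 2 ≤ p ^ 2 := by nlinarith
  -- Near -π²k² the value `sqDiff v` lies around the branch cut, so the holomorphic square root is w
  -- = i t with t close to πk.
  set t : ℂ → ℂ := fun v => csqrt (-sqDiff v) with ht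
  have hball : ∀ v ∈ Metric.ball a (3 * (2 * n)), ‖v - a‖ < 6 * n := fun v hv => by
    have : ‖v - a‖ < 3 * (2 * n) := by simpa [dist_eq_norm] using hv
    linarith
  have hnorm : ∀ v ∈ Metric.ball a (3 * (2 * n)), 8 * n ^ 2 ≤ ‖v‖ := by
    intro v hv
    have h1 := hball v hv
    have h2 := norm_sub_norm_le a v
    rw [norm_sub_rev, hna] at h2
    nlinarith
  have h100 : ∀ v ∈ Metric.ball a (3 * (2 * n)), 100 ≤ ‖v‖ := fun v hv => by
    nlinarith [hnorm v hv]
  have hsq : ∀ v ∈ Metric.ball a (3 * (2 * n)), ‖sqDiff v - a‖ ≤ 6.02 * n := by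
    intro v hv
    have h1 := hball v hv
    have h2 := norm_sqDiff_sub_le (h100 v hv)
    have h3 := norm_add_le (sqDiff v - v) (v - a)
    rw [sub_add_sub_cancel] at h3
    linarith
  have hre : ∀ v ∈ Metric.ball a (3 * (2 * n)), v.re ≤ -2 := by
    intro v hv
    have h1 := (abs_le.1 ((Complex.abs_re_le_norm (v - a)).trans (hball v hv).le)).2
    rw [Complex.sub_re, hare] at h1
    nlinarith
  have hslit : ∀ v ∈ Metric.ball a (3 * (2 * n)), -sqDiff v ∈ Complex.slitPlane := by
    intro v hv
    left
    have h1 := (abs_le.1 ((Complex.abs_re_le_norm (sqDiff v - a)).trans (hsq v hv))).2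
    rw [Complex.sub_re, hare] at h1
    rw [Complex.neg_re]
    nlinarith
  have htsq : ∀ v ∈ Metric.ball a (3 * (2 * n)), t v ^ 2 = -sqDiff v := fun v hv =>
    csqrt_sq (Complex.slitPlane_ne_zero (hslit v hv))
  have ht0 : ∀ v, 0 ≤ (t v).re := fun v => csqrt_re_nonneg _
  -- Bootstrap from (t - p)(t + p) = O(n): Re t ≥ 0 gives |t + p| ≥ p and |t - p| ≤ 2. Then |t + p|
  -- ≥ 2p - 2, which improves the bound to 1.
  have htp : ∀ v ∈ Metric.ball a (3 * (2 * n)), ‖t v - p‖ ≤ 1 := by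
    intro v hv
    have e : (t v - p) * (t v + p) = -(sqDiff v - a) := by
      linear_combination htsq v hv - hap
    have h1 : ‖t v - p‖ * ‖t v + p‖ ≤ 6.02 * n := by
      rw [← norm_mul, e, norm_neg]; exact hsq v hv
    have h2 : p ≤ ‖t v + p‖ := by
      have := Complex.re_le_norm (t v + p)
      rw [Complex.add_re, Complex.ofReal_re] at this
      linarith [ht0 v]
    have h3 : ‖t v - p‖ ≤ 2 := by
      by_contra! hlt
      nlinarith
    have h4 : 2 * p - 2 ≤ ‖t v + p‖ := by
      have h5 := norm_sub_norm_le (2 * p : ℂ) (p - t v)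
      rw [norm_sub_rev (p : ℂ), norm_mul, Complex.norm_real, Real.norm_eq_abs,
        abs_of_pos (by nlinarith), Complex.norm_ofNat] at h5
      have e2 : (2 * p : ℂ) - (p - t v) = t v + p := by ring
      rw [e2] at h5
      linarith
    by_contra! hlt
    nlinarith
  set w : ℂ → ℂ := fun v => Complex.I * t v with hw
  have hwsq : ∀ v ∈ Metric.ball a (3 * (2 * n)), w v ^ 2 = sqDiff v := fun v hv => by
    simp only [hw]
    rw [mul_pow, Complex.I_sq, htsq v hv]
    ring
  have hwp : ∀ v ∈ Metric.ball a (3 * (2 * n)), ‖w v - Complex.I * p‖ ≤ 1 := fun v hv => by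
    simp only [hw]
    rw [← mul_sub, norm_mul, Complex.norm_I, one_mul]
    exact htp v hv
  have hwre : ∀ v ∈ Metric.ball a (3 * (2 * n)), -1 ≤ (w v).re := by
    intro v hv
    have h1 := (abs_le.1 ((Complex.abs_re_le_norm _).trans (hwp v hv))).1
    simpa using h1
  have he1 : ∀ v ∈ Metric.ball a (3 * (2 * n)), ‖Complex.exp (bigRoot v)‖ ≤ 1 / 2 := by
    intro v hv
    refine (exp_bigRoot_norm (h100 v hv)).trans ?_
    have h2 : v.re + 1 / 100 ≤ -Real.log 2 := by linarith [hre v hv, Real.log_two_lt_d9]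
    refine (Real.exp_le_exp.2 h2).trans ?_
    rw [Real.exp_neg, Real.exp_log two_pos]
    norm_num
  have hq : ∀ v ∈ Metric.ball a (3 * (2 * n)), 1 / 2 ≤ ‖1 - Complex.exp (bigRoot v)‖ := by
    intro v hv
    have h2 := norm_sub_norm_le (1 : ℂ) (Complex.exp (bigRoot v))
    rw [norm_one] at h2
    linarith [he1 v hv]
  have hq0 : ∀ v ∈ Metric.ball a (3 * (2 * n)), 1 - Complex.exp (bigRoot v) ≠ 0 := fun v hv h => by
    have := hq v hv
    rw [h, norm_zero] at this
    norm_num at this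
  set ε : ℂ → ℂ := fun v => charRem v (w v) / (1 - Complex.exp (bigRoot v)) with hε
  have hεb : ∀ v ∈ Metric.ball a (3 * (2 * n)), ‖ε v‖ ≤ 20 / n ^ 2 := by
    intro v hv
    have h1 := norm_charRem_le (h100 v hv) (hwsq v hv) (hwre v hv)
    rw [max_eq_left ((he1 v hv).trans (by norm_num))] at h1
    simp only [hε]
    rw [norm_div, div_le_div_iff₀ (by linarith [hq v hv]) (by positivity)]
    have h3 : ‖charRem v (w v)‖ * n ^ 2 ≤ 10 := by
      calc ‖charRem v (w v)‖ * n ^ 2 ≤ (80 * 1 / (8 * n ^ 2)) * n ^ 2 := by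
            gcongr
            refine h1.trans ?_
            gcongr
            exact hnorm v hv
        _ = 10 := by field_simp; norm_num
    linarith [hq v hv]
  have hn2 : 10000 ≤ n ^ 2 := by nlinarith
  have hnb : 20 / n ^ 2 ≤ 1 / 2 := by
    rw [div_le_div_iff₀ (by positivity) two_pos]; linarith
  have hdw : ∀ v ∈ Metric.ball a (3 * (2 * n)), DifferentiableAt ℂ w v := fun v hv =>
    (DifferentiableAt.comp (g := csqrt) v (differentiableAt_csqrt (hslit v hv))
      (differentiableAt_sqDiff (ne_zero_of_le_norm (h100 v hv))).neg).const_mul _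
  have hdε : ∀ v ∈ Metric.ball a (3 * (2 * n)), DifferentiableAt ℂ ε v := by
    intro v hv
    have h1 := hdw v hv
    have h2 := differentiableAt_bigRoot (ne_zero_of_le_norm (h100 v hv))
    exact (differentiableAt_charRem (h100 v hv) h1).div (by fun_prop) (hq0 v hv)
  set δ : ℂ → ℂ := fun v => -Complex.log (1 + ε v) / 2 with hδ
  have hδb : ∀ v ∈ Metric.ball a (3 * (2 * n)), ‖δ v‖ ≤ 15 / n ^ 2 := by
    intro v hv
    have h1 := norm_log_one_add_le_of_le (hεb v hv) hnb
    simp only [hδ]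
    rw [norm_div, norm_neg, Complex.norm_ofNat]
    refine (div_le_div_of_nonneg_right h1 two_pos.le).trans (le_of_eq ?_)
    ring
  have hδ1 : ∀ v ∈ Metric.ball a (3 * (2 * n)), ‖δ v‖ ≤ 15 / 10000 := fun v hv =>
    (hδb v hv).trans (by gcongr)
  -- Taking logarithms in exp(-2w) = 1 + ε gives w = ip + δ. Squaring and using w² = `sqDiff v`
  -- turns this into a fixed point equation for v.
  have hzero : ∀ v ∈ Metric.closedBall a (2 * n), (charDet (param v) = 0 ↔
      v = a + ((v - sqDiff v) + (2 * (Complex.I * p) * δ v + δ v ^ 2))) := by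
    intro v hv
    have hvb : v ∈ Metric.ball a (3 * (2 * n)) :=
      Metric.closedBall_subset_ball (by linarith) hv
    have hx : ‖-(2 * w v) - 2 * Real.pi * Complex.I * ((-k : ℤ) : ℂ)‖ ≤ 2 := by
      have e : -(2 * w v) - 2 * Real.pi * Complex.I * ((-k : ℤ) : ℂ) =
          -2 * (w v - Complex.I * p) := by
        simp only [hp, hn]; push_cast; ring
      rw [e, norm_mul, norm_neg, Complex.norm_ofNat]
      linarith [hwp v hvb]
    have h1 : charDet (param v) = 0 ↔ Complex.exp (-(2 * w v)) = 1 + ε v := by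
      rw [charDet_param_eq_zero_iff (h100 v hvb) (hwsq v hvb), ← sub_eq_iff_eq_add',
        eq_div_iff (hq0 v hvb)]
      constructor <;> intro h <;> linear_combination h
    have h2 : charDet (param v) = 0 ↔ w v = Complex.I * p + δ v := by
      rw [h1, exp_eq_one_add_iff (-k) hx ((hεb v hvb).trans hnb)]
      simp only [hδ, hp, hn]
      push_cast
      constructor <;> intro h
      · linear_combination -h / 2
      · linear_combination -2 * h
    rw [h2]
    constructor
    · intro h
      have h3 := hwsq v hvb
      rw [h] at h3
      linear_combination -h3 - hap + (p : ℂ) ^ 2 * Complex.I_sq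
    · intro h
      have h3 : (w v - (Complex.I * p + δ v)) * (w v + (Complex.I * p + δ v)) = 0 := by
        linear_combination hwsq v hvb + h + hap - (p : ℂ) ^ 2 * Complex.I_sq
      rcases mul_eq_zero.1 h3 with h4 | h4
      · exact sub_eq_zero.1 h4
      -- Squaring admits the spurious root w = -(ip + δ), which is too far from ip.
      · exfalso
        have h5 : w v - Complex.I * p = -(2 * Complex.I * p + δ v) := by linear_combination h4
        have h6 := hwp v hvb
        rw [h5, norm_neg] at h6
        have h7 := norm_sub_norm_le (2 * Complex.I * p) (-δ v)
        rw [sub_neg_eq_add, norm_neg, norm_mul, norm_mul, Complex.norm_I, Complex.norm_ofNat,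
          Complex.norm_real, Real.norm_eq_abs, abs_of_pos (by nlinarith)] at h7
        linarith [hδ1 v hvb]
  have hFb : ∀ v ∈ Metric.ball a (3 * (2 * n)),
      ‖(v - sqDiff v) + (2 * (Complex.I * p) * δ v + δ v ^ 2)‖ ≤ 4 := by
    intro v hv
    have h1 := norm_sqDiff_sub_le (h100 v hv)
    rw [norm_sub_rev] at h1
    have h2 : ‖2 * (Complex.I * p) * δ v‖ ≤ 1 := by
      rw [norm_mul, norm_mul, norm_mul, Complex.norm_I, Complex.norm_ofNat, Complex.norm_real,
        Real.norm_eq_abs, abs_of_pos (by nlinarith)]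
      calc 2 * (1 * p) * ‖δ v‖ ≤ 2 * (1 * (3.15 * n)) * (15 / n ^ 2) := by
            gcongr
            exact hδb v hv
        _ = 94.5 / n := by field_simp; norm_num
        _ ≤ 1 := by rw [div_le_one hn0]; linarith
    have h3 : ‖δ v ^ 2‖ ≤ 1 := by
      rw [norm_pow]
      nlinarith [hδ1 v hv, norm_nonneg (δ v)]
    have h4 := norm_add_le (v - sqDiff v) (2 * (Complex.I * p) * δ v + δ v ^ 2)
    have h5 := norm_add_le (2 * (Complex.I * p) * δ v) (δ v ^ 2)
    linarith
  have hFd : DifferentiableOn ℂ (fun v => (v - sqDiff v) +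
      (2 * (Complex.I * p) * δ v + δ v ^ 2)) (Metric.ball a (3 * (2 * n))) := by
    intro v hv
    refine DifferentiableAt.differentiableWithinAt ?_
    have h1 : DifferentiableAt ℂ δ v := ((((hdε v hv).const_add 1).clog
      (one_add_mem_slitPlane ((hεb v hv).trans hnb))).neg).div_const 2
    have h2 := differentiableAt_sqDiff (ne_zero_of_le_norm (h100 v hv))
    fun_prop
  obtain ⟨v, hv, hfix, huniq⟩ := existsUnique_fixedPoint (by linarith) hFd hFb
    (by linarith)
  refine ⟨v, ?_, (hzero v hv).2 hfix, fun u hu hz => ?_⟩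
  · have h1 := hFb v (Metric.closedBall_subset_ball (by linarith) hv)
    rwa [← sub_eq_iff_eq_add'.2 hfix] at h1
  · have hu' : u ∈ Metric.closedBall a (2 * n) := by simpa [dist_eq_norm] using hu
    exact huniq u hu' ((hzero u hu').1 hz)

/-- Every large zero of the characteristic function is close to some `2 π i k` or `-π² k²`. -/
theorem large_zero_cases {v : ℂ} (hv : 100000 ≤ ‖v‖) (hz : charDet (param v) = 0) :
    (∃ k : ℤ, ‖v - 2 * Real.pi * Complex.I * k‖ ≤ 1) ∨
      ∃ k : ℕ, ‖v - -(Real.pi * k) ^ 2‖ ≤ 2 * k := by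
  have h100 : 100 ≤ ‖v‖ := by linarith
  have hs0 : sqDiff v ≠ 0 := by
    intro h
    have := norm_sqDiff_sub_le h100
    rw [h, zero_sub, norm_neg] at this
    linarith
  set w := csqrt (sqDiff v) with hw
  have hwsq : w ^ 2 = sqDiff v := csqrt_sq hs0
  have hw0 : 0 ≤ w.re := csqrt_re_nonneg _
  have hW := norm_charRem_le h100 hwsq (by linarith)
  rw [charDet_param_eq_zero_iff h100 hwsq] at hz
  rw [← hz, norm_mul, le_div_iff₀ (by linarith)] at hW
  set e := ‖Complex.exp (bigRoot v) - 1‖ with he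
  set q := ‖1 - Complex.exp (-(2 * w))‖ with hq
  have he0 : 0 ≤ e := norm_nonneg _
  have hM : max 1 ‖Complex.exp (bigRoot v)‖ ≤ 1 + e := by
    refine max_le (by linarith) ?_
    have := norm_add_le (Complex.exp (bigRoot v) - 1) 1
    rw [sub_add_cancel, norm_one] at this
    linarith
  -- The product of the two factors is O((1 + e)/|v|). If q is not small, then e must be; no a
  -- priori bound on exp m₁ is needed.
  rcases le_or_gt q (1 / 10) with hq1 | hq1
  · right
    rw [hq, norm_sub_rev] at hq1
    obtain ⟨k, hk⟩ := exists_int_near_of_exp_near hq1 (by norm_num)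
    refine ⟨k.natAbs, ?_⟩
    set n : ℝ := ((k.natAbs : ℕ) : ℝ) with hn
    have hnk : n = |(k : ℝ)| := by rw [hn, Nat.cast_natAbs, Int.cast_abs]
    have hnsq : ((k.natAbs : ℕ) : ℂ) ^ 2 = (k : ℂ) ^ 2 := by
      have : (n : ℂ) ^ 2 = (k : ℂ) ^ 2 := by
        rw [hnk, ← Complex.ofReal_pow, sq_abs]; push_cast; rfl
      rw [← this, hn]; push_cast; rfl
    set ρ : ℂ := w + Real.pi * Complex.I * k with hρ
    have hρb : ‖ρ‖ ≤ 3 / 40 := by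
      have e1 : -(2 * w) - 2 * Real.pi * Complex.I * k = -2 * ρ := by rw [hρ]; ring
      rw [e1, norm_mul, norm_neg, Complex.norm_ofNat] at hk
      linarith
    have e2 : v - -(Real.pi * (k.natAbs : ℕ)) ^ 2 =
        -(sqDiff v - v) + (-(2 * Real.pi * Complex.I * k) * ρ + ρ ^ 2) := by
      rw [mul_pow, hnsq, ← hwsq, hρ]
      linear_combination ((Real.pi : ℂ) ^ 2 * (k : ℂ) ^ 2) * Complex.I_sq
    have b1 := norm_sqDiff_sub_le h100
    have b2 : ‖-(2 * Real.pi * Complex.I * k) * ρ‖ ≤ 2 * 3.15 * n * (3 / 40) := by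
      rw [norm_mul, norm_neg, norm_two_pi_I_mul_int, ← hnk]
      gcongr
      exact Real.pi_lt_d2.le
    have b3 : ‖ρ ^ 2‖ ≤ 1 / 10 := by
      rw [norm_pow]; nlinarith [norm_nonneg ρ]
    have b4 : ‖v - -(Real.pi * (k.natAbs : ℕ)) ^ 2‖ ≤ 2.1 + 0.4725 * n := by
      rw [e2]
      refine (norm_add_le _ _).trans ?_
      rw [norm_neg]
      have := norm_add_le (-(2 * Real.pi * Complex.I * k) * ρ) (ρ ^ 2)
      linarith
    have hn0 : 0 ≤ n := by rw [hnk]; positivity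
    -- A small index would contradict |v| ≥ 100000; for n ≥ 10 the error 2.1 + 0.4725 n is at most
    -- 2n.
    have hnn : 10 ≤ n := by
      by_contra! hlt
      have h1 := norm_sub_norm_le v (-(Real.pi * (k.natAbs : ℕ)) ^ 2)
      have h2 : ‖-(Real.pi * (k.natAbs : ℕ) : ℂ) ^ 2‖ = Real.pi ^ 2 * n ^ 2 := by
        rw [norm_neg, norm_pow, norm_mul, Complex.norm_real, Real.norm_eq_abs,
          abs_of_pos Real.pi_pos, Complex.norm_natCast, mul_pow]
      rw [h2] at h1
      have h3 : Real.pi ^ 2 * n ^ 2 ≤ 3.15 ^ 2 * 10 ^ 2 := by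
        gcongr
        exact Real.pi_lt_d2.le
      norm_num at h3
      linarith
    linarith
  · left
    have h1 : e * (1 / 10) * 100000 ≤ 80 * (1 + e) := by
      calc e * (1 / 10) * 100000 ≤ e * q * ‖v‖ := by gcongr
        _ ≤ _ := hW.trans (by gcongr)
    have h2 : e ≤ 1 / 10 := by linarith
    obtain ⟨k, hk⟩ := exists_int_near_of_exp_near h2 (by norm_num)
    refine ⟨k, ?_⟩
    have h3 := norm_sub_le (bigRoot v - 2 * Real.pi * Complex.I * k) (bigRoot v - v)
    rw [sub_sub_sub_cancel_left] at h3
    linarith [norm_bigRoot_sub_le h100]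

/-- The equation reads v = (z + 1) + 1/v - 1/v², a contraction near z + 1. Thus the parametrization
loses no large eigenvalue. -/
theorem exists_param_eq {z : ℂ} (hz : 200 ≤ ‖z‖) : ∃ v : ℂ, param v = z ∧ ‖z‖ - 2 ≤ ‖v‖ := by
  have hn : ∀ v : ℂ, ‖v - (z + 1)‖ ≤ 3 → 100 ≤ ‖v‖ := by
    intro v hv
    have h1 := norm_sub_norm_le (z + 1) v
    have h2 := norm_sub_norm_le z (-1)
    rw [sub_neg_eq_add, norm_neg, norm_one] at h2
    rw [norm_sub_rev] at h1
    linarith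
  have hb : ∀ v ∈ Metric.ball (z + 1) (3 * 1), 100 ≤ ‖v‖ := fun v hv =>
    hn v (by
      have : ‖v - (z + 1)‖ < 3 * 1 := by simpa [dist_eq_norm] using hv
      linarith)
  obtain ⟨v, hv, hfix, -⟩ := existsUnique_fixedPoint (f := fun v => v⁻¹ - v⁻¹ ^ 2) (a := z + 1)
    (b := 1 / 2) one_pos
    (fun v hv => by
      have := ne_zero_of_le_norm (hb v hv)
      refine DifferentiableAt.differentiableWithinAt ?_
      fun_prop (disch := assumption))
    (fun v hv => by
      have h1 := norm_inv_le_of_le (hb v hv)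
      have h2 := norm_sub_le v⁻¹ (v⁻¹ ^ 2)
      rw [norm_pow] at h2
      nlinarith [norm_nonneg v⁻¹])
    le_rfl
  refine ⟨v, ?_, ?_⟩
  · rw [param]
    linear_combination hfix
  · have hv' : ‖v - (z + 1)‖ ≤ 1 := by simpa [dist_eq_norm] using hv
    have h1 := norm_sub_norm_le (z + 1) v
    have h2 := norm_sub_norm_le z (-1)
    rw [sub_neg_eq_add, norm_neg, norm_one] at h2
    rw [norm_sub_rev] at h1
    linarith

/-- A large positive v is far from the imaginary axis and from the negative numbers -π²k². This
shows that `charDet` is not identically zero. -/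
theorem charDet_ne_zero_of_large_real : charDet (param ((1000000 : ℝ) : ℂ)) ≠ 0 := by
  intro h
  have hn : ‖((1000000 : ℝ) : ℂ)‖ = 1000000 := by
    rw [Complex.norm_real]; norm_num
  rcases large_zero_cases (by rw [hn]; norm_num) h with ⟨k, hk⟩ | ⟨k, hk⟩
  · have h1 := (abs_le.1 ((Complex.abs_re_le_norm _).trans hk)).2
    simp at h1
  · have h1 := (abs_le.1 ((Complex.abs_re_le_norm _).trans hk)).2
    have e : (((1000000 : ℝ) : ℂ) - -(Real.pi * (k : ℂ)) ^ 2).re = 1000000 + (Real.pi * k) ^ 2 := by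
      have : (((1000000 : ℝ) : ℂ) - -(Real.pi * (k : ℂ)) ^ 2) =
          ((1000000 + (Real.pi * k) ^ 2 : ℝ) : ℂ) := by push_cast; ring
      rw [this, Complex.ofReal_re]
    rw [e] at h1
    have h2 : (3 * (k : ℝ)) ^ 2 ≤ (Real.pi * k) ^ 2 := by
      gcongr
      exact Real.pi_gt_three.le
    nlinarith [sq_nonneg ((k : ℝ) - 1)]

theorem tendsto_abs_intCast_cofinite : Tendsto (fun k : ℤ => |(k : ℝ)|) cofinite atTop :=
  (tendsto_norm_cocompact_atTop (E := ℝ)).comp Int.tendsto_coe_cofinite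

end NSSpectrum

end

/-! ### Assembling the three families -/

theorem lemma3p2 :
    ∃ (k₀ n₀ : ℕ) (lamP : ℕ → ℂ) (lamH : ℤ → ℂ) (lamHat : Fin n₀ → ℂ)
      (c d : ℕ → ℝ) (α₁ α₂ : ℤ → ℝ),
      1 ≤ k₀ ∧ 1 ≤ n₀ ∧
      -- the three families exhaust the spectrum, which consists of eigenvalues
      NSSpectrum.spectrum NSSpectrum.adjointOp =
        {z | ∃ k : ℕ, k₀ ≤ k ∧ z = lamP k} ∪ {z | ∃ k : ℤ, (k₀ : ℤ) ≤ |k| ∧ z = lamH k} ∪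
          Set.range lamHat ∧
      NSSpectrum.eigenvalues NSSpectrum.adjointOp =
        NSSpectrum.spectrum NSSpectrum.adjointOp ∧
      -- the parabolic branch
      (fun k : ℕ => lamP k -
          (-((k : ℂ) ^ 2 * (Real.pi : ℂ) ^ 2) - 2 * (c k : ℂ) * (k * Real.pi)
            - 2 * Complex.I * (d k : ℂ) * (k * Real.pi)))
        =O[atTop] (fun _ => (1 : ℝ)) ∧
      -- the hyperbolic branch
      (∀ k : ℤ, (k₀ : ℤ) ≤ |k| →
        lamH k = -1 - (α₁ k : ℂ) - Complex.I * (2 * k * Real.pi + (α₂ k : ℂ))) ∧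
      -- bounds and decay of the correction sequences (`cofinite` on `ℤ` means `|k| → ∞`)
      (∀ k : ℕ, k₀ ≤ k → |c k| ≤ Real.pi / 2 ∧ |d k| ≤ Real.pi / 2) ∧
      (∀ k : ℤ, (k₀ : ℤ) ≤ |k| → |α₁ k| ≤ Real.pi / 2 ∧ |α₂ k| ≤ Real.pi / 2) ∧
      Tendsto c atTop (𝓝 0) ∧ Tendsto d atTop (𝓝 0) ∧
      Tendsto α₁ cofinite (𝓝 0) ∧ Tendsto α₂ cofinite (𝓝 0) ∧
      c =O[atTop] (fun k : ℕ => (k : ℝ)⁻¹) ∧ d =O[atTop] (fun k : ℕ => (k : ℝ)⁻¹) ∧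
      α₁ =O[cofinite] (fun k : ℤ => |(k : ℝ)|⁻¹) ∧
      α₂ =O[cofinite] (fun k : ℤ => |(k : ℝ)|⁻¹) := by
  have hP : ∀ k : ℕ, ∃ v : ℂ, (100 : ℝ) ≤ k → ‖v - -(Real.pi * k) ^ 2‖ ≤ 4 ∧
      NSSpectrum.charDet (NSSpectrum.param v) = 0 ∧
      ∀ u : ℂ, ‖u - -(Real.pi * k) ^ 2‖ ≤ 2 * k → NSSpectrum.charDet (NSSpectrum.param u) = 0 → u = v := by
    intro k
    by_cases hk : (100 : ℝ) ≤ k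
    · obtain ⟨v, hv⟩ := NSSpectrum.exists_parabolic_zero k hk
      exact ⟨v, fun _ => hv⟩
    · exact ⟨0, fun h => absurd h hk⟩
  have hH : ∀ k : ℤ, ∃ v : ℂ, (5000 : ℝ) ≤ |(k : ℝ)| →
      ‖v - 2 * Real.pi * Complex.I * k‖ ≤ 2401 / |(k : ℝ)| ∧ NSSpectrum.charDet (NSSpectrum.param v) = 0 ∧
      ∀ u : ℂ, ‖u - 2 * Real.pi * Complex.I * k‖ ≤ 1 → NSSpectrum.charDet (NSSpectrum.param u) = 0 → u = v := by
    intro k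
    by_cases hk : (5000 : ℝ) ≤ |(k : ℝ)|
    · obtain ⟨v, hv⟩ := NSSpectrum.exists_hyperbolic_zero k hk
      exact ⟨v, fun _ => hv⟩
    · exact ⟨0, fun h => absurd h hk⟩
  choose vP hvP using hP
  choose vH hvH using hH
  set lamP : ℕ → ℂ := fun k => NSSpectrum.param (vP k) with hlamP
  set lamH : ℤ → ℂ := fun k => NSSpectrum.param (vH (-k)) with hlamH
  set rP : ℕ → ℂ := fun k => lamP k + (k : ℂ) ^ 2 * (Real.pi : ℂ) ^ 2 with hrP
  set rH : ℤ → ℂ := fun k => lamH k + 1 + Complex.I * (2 * k * Real.pi) with hrH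
  have hpi3 := Real.pi_gt_three
  have hrem : ∀ v : ℂ, 100 ≤ ‖v‖ → ‖v⁻¹ ^ 2 - v⁻¹‖ ≤ 2 * ‖v⁻¹‖ := by
    intro v hv
    have h1 := NSSpectrum.norm_inv_le_of_le hv
    have h2 := norm_sub_le (v⁻¹ ^ 2) v⁻¹
    rw [norm_pow] at h2
    nlinarith [norm_nonneg v⁻¹]
  have hrPb : ∀ k : ℕ, (100 : ℝ) ≤ k → ‖rP k‖ ≤ 6 := by
    intro k hk
    have h1 := (hvP k hk).1
    have h2 : 100 ≤ ‖vP k‖ := by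
      have h3 := norm_sub_norm_le (-(Real.pi * (k : ℂ)) ^ 2) (vP k)
      rw [norm_sub_rev, norm_neg, norm_pow, norm_mul, Complex.norm_real, Real.norm_eq_abs,
        abs_of_pos Real.pi_pos, Complex.norm_natCast] at h3
      nlinarith [mul_le_mul hpi3.le hk (by norm_num) Real.pi_pos.le]
    have h3 := hrem _ h2
    have h4 := NSSpectrum.norm_inv_le_of_le h2
    have e : rP k = -1 + ((vP k - -(Real.pi * k) ^ 2) + ((vP k)⁻¹ ^ 2 - (vP k)⁻¹)) := by
      simp only [hrP, hlamP, NSSpectrum.param]; ring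
    rw [e]
    have h5 := norm_add_le (-1) ((vP k - -(Real.pi * k) ^ 2) + ((vP k)⁻¹ ^ 2 - (vP k)⁻¹))
    have h6 := norm_add_le (vP k - -(Real.pi * k) ^ 2) ((vP k)⁻¹ ^ 2 - (vP k)⁻¹)
    rw [norm_neg, norm_one] at h5
    linarith
  have hrHb : ∀ k : ℤ, (5000 : ℝ) ≤ |(k : ℝ)| → ‖rH k‖ ≤ 2403 / |(k : ℝ)| := by
    intro k hk
    have habs : |((-k : ℤ) : ℝ)| = |(k : ℝ)| := by push_cast; exact abs_neg _
    have hk0 : 0 < |(k : ℝ)| := by linarith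
    have h1 := (hvH (-k) (by rw [habs]; exact hk)).1
    rw [habs] at h1
    have h0 : 2401 / |(k : ℝ)| ≤ 1 := by rw [div_le_one hk0]; linarith
    have h2 : |(k : ℝ)| ≤ ‖vH (-k)‖ := by
      have h3 := norm_sub_norm_le (2 * Real.pi * Complex.I * ((-k : ℤ) : ℂ)) (vH (-k))
      rw [norm_sub_rev, NSSpectrum.norm_two_pi_I_mul_int, habs] at h3
      nlinarith
    have h3 := hrem (vH (-k)) (by linarith)
    have h4 : ‖(vH (-k))⁻¹‖ ≤ 1 / |(k : ℝ)| := by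
      rw [norm_inv, one_div]
      exact inv_anti₀ hk0 h2
    have e : rH k = (vH (-k) - 2 * Real.pi * Complex.I * ((-k : ℤ) : ℂ)) +
        ((vH (-k))⁻¹ ^ 2 - (vH (-k))⁻¹) := by
      simp only [hrH, hlamH, NSSpectrum.param]; push_cast; ring
    rw [e]
    refine (norm_add_le _ _).trans ?_
    have e2 : 2403 / |(k : ℝ)| = 2401 / |(k : ℝ)| + 2 * (1 / |(k : ℝ)|) := by ring
    rw [e2]
    linarith
  -- The point `lamP 5000` only guarantees that the finite family is nonempty. Beyond the radius one
  -- has |v| ≥ 10⁹, which forces the index of the nearby point to be at least 5000 on either branch.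
  set S : Set ℂ := {z | NSSpectrum.charDet z = 0 ∧ ‖z‖ ≤ 10 ^ 9 + 2} ∪ {lamP 5000} with hS
  have hSfin : S.Finite :=
    (NSSpectrum.finite_zeros_charDet ⟨_, NSSpectrum.charDet_ne_zero_of_large_real⟩ _).union (finite_singleton _)
  have hcast : ∀ {k : ℤ}, ((5000 : ℕ) : ℤ) ≤ |k| → (5000 : ℝ) ≤ |(k : ℝ)| := by
    intro k hk
    have : (((5000 : ℕ) : ℤ) : ℝ) ≤ ((|k| : ℤ) : ℝ) := Int.cast_le.2 hk
    simpa using this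
  have hcastP : ∀ {k : ℕ}, 5000 ≤ k → (100 : ℝ) ≤ k := by
    intro k hk
    have : (5000 : ℝ) ≤ k := by exact_mod_cast hk
    linarith
  have hα : ∀ a : ℤ → ℝ, (∀ k, |a k| ≤ ‖rH k‖) →
      (∀ k : ℤ, ((5000 : ℕ) : ℤ) ≤ |k| → |a k| ≤ Real.pi / 2) ∧ Tendsto a cofinite (𝓝 0) ∧
        a =O[cofinite] (fun k : ℤ => |(k : ℝ)|⁻¹) := by
    intro a ha
    have hO : a =O[cofinite] (fun k : ℤ => |(k : ℝ)|⁻¹) := by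
      refine IsBigO.of_bound 2403 ?_
      filter_upwards [NSSpectrum.tendsto_abs_intCast_cofinite.eventually_ge_atTop 5000] with k hk
      rw [norm_inv, norm_abs_eq_norm, Real.norm_eq_abs, Real.norm_eq_abs, ← div_eq_mul_inv]
      exact (ha k).trans (hrHb k hk)
    refine ⟨fun k hk => ?_, hO.trans_tendsto NSSpectrum.tendsto_abs_intCast_cofinite.inv_tendsto_atTop, hO⟩
    refine ((ha k).trans (hrHb k (hcast hk))).trans ?_
    have := hcast hk
    rw [div_le_iff₀ (by linarith)]
    nlinarith
  have hcd : ∀ a : ℕ → ℝ, (∀ k, |a k| ≤ ‖rP k‖) →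
      (∀ k : ℕ, 5000 ≤ k → |-a k / (2 * (k * Real.pi))| ≤ Real.pi / 2) ∧
      Tendsto (fun k : ℕ => -a k / (2 * (k * Real.pi))) atTop (𝓝 0) ∧
        (fun k : ℕ => -a k / (2 * (k * Real.pi))) =O[atTop] (fun k : ℕ => (k : ℝ)⁻¹) := by
    intro a ha
    have hb : ∀ k : ℕ, (100 : ℝ) ≤ k → |-a k / (2 * (k * Real.pi))| ≤ 1 * (k : ℝ)⁻¹ := by
      intro k hk
      have hk0 : (0 : ℝ) < k := by linarith
      rw [abs_div, abs_neg, abs_of_pos (a := 2 * (k * Real.pi)) (by positivity),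
        ← div_eq_mul_inv, div_le_div_iff₀ (by positivity) hk0]
      have := (ha k).trans (hrPb k hk)
      nlinarith
    have hO : (fun k : ℕ => -a k / (2 * (k * Real.pi))) =O[atTop] (fun k : ℕ => (k : ℝ)⁻¹) := by
      refine IsBigO.of_bound 1 ?_
      filter_upwards [tendsto_natCast_atTop_atTop.eventually_ge_atTop (100 : ℝ)] with k hk
      rw [norm_inv, Real.norm_natCast, Real.norm_eq_abs]
      exact hb k hk
    refine ⟨fun k hk => (hb k (hcastP hk)).trans ?_,
      hO.trans_tendsto tendsto_inv_atTop_nhds_zero_nat, hO⟩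
    have h1 := inv_anti₀ (by norm_num) (hcastP hk)
    linarith
  obtain ⟨hα1b, hα1t, hα1O⟩ := hα (fun k => -(rH k).re)
    (fun k => by rw [abs_neg]; exact Complex.abs_re_le_norm _)
  obtain ⟨hα2b, hα2t, hα2O⟩ := hα (fun k => -(rH k).im)
    (fun k => by rw [abs_neg]; exact Complex.abs_im_le_norm _)
  obtain ⟨hcb, hct, hcO⟩ := hcd (fun k => (rP k).re) (fun k => Complex.abs_re_le_norm _)
  obtain ⟨hdb, hdt, hdO⟩ := hcd (fun k => (rP k).im) (fun k => Complex.abs_im_le_norm _)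
  -- The sequences c and d absorb the whole bounded error `rP`, divided by -2kπ. Hence they are
  -- O(1/k), and the O(1) remainder vanishes for k ≥ 1.
  refine ⟨5000, hSfin.toFinset.card, lamP, lamH, fun i => hSfin.toFinset.equivFin.symm i,
    fun k => -(rP k).re / (2 * (k * Real.pi)), fun k => -(rP k).im / (2 * (k * Real.pi)),
    fun k => -(rH k).re, fun k => -(rH k).im, by norm_num, ?_, ?_, ?_, ?_, ?_,
    fun k hk => ⟨hcb k hk, hdb k hk⟩, fun k hk => ⟨hα1b k hk, hα2b k hk⟩,
    hct, hdt, hα1t, hα2t, hcO, hdO, hα1O, hα2O⟩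
  · exact Finset.card_pos.2 ⟨lamP 5000, by simp [hS]⟩
  · have hrange : Set.range (fun i => (hSfin.toFinset.equivFin.symm i : ℂ)) = S := by
      ext z
      constructor
      · rintro ⟨i, rfl⟩
        exact hSfin.mem_toFinset.1 (hSfin.toFinset.equivFin.symm i).2
      · intro hz
        exact ⟨hSfin.toFinset.equivFin ⟨z, hSfin.mem_toFinset.2 hz⟩, by simp⟩
    rw [hrange, NSSpectrum.spectrum_adjointOp_eq]
    ext z
    simp only [mem_ofPred_eq, mem_union]
    constructor
    · intro hz
      by_cases hR : ‖z‖ ≤ 10 ^ 9 + 2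
      · right
        exact Or.inl ⟨hz, hR⟩
      · left
        push Not at hR
        obtain ⟨v, rfl, hv⟩ := NSSpectrum.exists_param_eq (z := z) (by norm_num at hR; linarith)
        have hv9 : (10 : ℝ) ^ 9 ≤ ‖v‖ := by linarith
        norm_num at hv9
        rcases NSSpectrum.large_zero_cases (by linarith) hz with ⟨k, hk⟩ | ⟨k, hk⟩
        · right
          have h1 := norm_sub_norm_le v (2 * Real.pi * Complex.I * k)
          rw [NSSpectrum.norm_two_pi_I_mul_int] at h1
          have hbig : (5000 : ℝ) ≤ |(k : ℝ)| := by
            by_contra! hlt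
            have := Real.pi_lt_four
            have h3 : Real.pi * |(k : ℝ)| ≤ 4 * 5000 := by gcongr
            linarith
          refine ⟨-k, ?_, ?_⟩
          · rw [abs_neg]
            have : ((5000 : ℤ) : ℝ) ≤ ((|k| : ℤ) : ℝ) := by simpa using hbig
            exact_mod_cast this
          · simp only [hlamH, neg_neg]
            rw [(hvH k hbig).2.2 v hk hz]
        · left
          have h1 := norm_sub_norm_le v (-(Real.pi * (k : ℂ)) ^ 2)
          rw [norm_neg, norm_pow, norm_mul, Complex.norm_real, Real.norm_eq_abs,
            abs_of_pos Real.pi_pos, Complex.norm_natCast] at h1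
          have hbig : (5000 : ℝ) ≤ k := by
            by_contra! hlt
            have := Real.pi_lt_four
            have h3 : (Real.pi * (k : ℝ)) ^ 2 ≤ (4 * 5000) ^ 2 := by gcongr
            norm_num at h3
            linarith
          refine ⟨k, by exact_mod_cast hbig, ?_⟩
          simp only [hlamP]
          rw [(hvP k (by linarith)).2.2 v hk hz]
    · rintro ((⟨k, hk, rfl⟩ | ⟨k, hk, rfl⟩) | hz)
      · exact (hvP k (hcastP hk)).2.1
      · exact (hvH (-k) (by push_cast; rw [abs_neg]; exact hcast hk)).2.1
      · rcases hz with hz | hz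
        · exact hz.1
        · rw [mem_singleton_iff.1 hz]
          exact (hvP 5000 (by norm_num)).2.1
  · rw [NSSpectrum.eigenvalues_adjointOp_eq, NSSpectrum.spectrum_adjointOp_eq]
  · refine IsBigO.of_bound 0 ?_
    filter_upwards [eventually_ge_atTop 1] with k hk
    rw [zero_mul]
    refine le_of_eq (norm_eq_zero.2 ?_)
    have hk0 : (k : ℂ) ≠ 0 := by exact_mod_cast (by omega : k ≠ 0)
    have hp0 : (Real.pi : ℂ) ≠ 0 := by exact_mod_cast Real.pi_ne_zero
    have e1 : lamP k = rP k - (k : ℂ) ^ 2 * (Real.pi : ℂ) ^ 2 := by simp only [hrP]; ring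
    have e2 := Complex.re_add_im (rP k)
    rw [e1]
    push_cast
    field_simp
    linear_combination -e2
  · intro k _
    have e1 : lamH k = rH k - 1 - Complex.I * (2 * k * Real.pi) := by simp only [hrH]; ring
    have e2 := Complex.re_add_im (rH k)
    rw [e1]
    push_cast
    linear_combination -e2
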